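/- Let $p>2$ be a prime and let $V_n^*$ be the space of binary forms of degree $n$ over $\mathbf F_p$ in the variables $x,y$, with dual space $V_n$ and natural pairing $(\cdot,\cdot)\colon V_n\times V_n^*\to\mathbf F_p$; let $(x^{n-i}y^i)^*$ be the basis of $V_n$ dual to the monomials. A form $v\in V_m^*$ with $m\le n$ lies in $w^\bot$ $(w\in V_n)$ if $(w,vu)=0$ for all $u\in V_{n-m}^*$; every form of degree $m>n$ lies in $w^\bot$. A nonzero form has splitting type $\langle d_1^{e_1},\dots,d_r^{e_r}\rangle$ if it is, up to a nonzero constant, $f_1^{e_1}\cdots f_r^{e_r}$ with pairwise non-proportional irreducible $f_i$ of degree $d_i$ and all $e_i>0$. For $n$ odd, the Waring type of $w\in V_n$ is the splitting type of the nonzero form of least degree in $w^\bot$ (for $w\neq0$ it is unique up to a scalar). For $w\in V_5$ put $$C(w)=-\sum_{[f]\in\mathbf P(V_2^*),\ f^2\in w^\bot}\left(\frac{\mathrm{Disc}(f)}{p}\right),\qquad \widehat\Phi(w)=\frac1{\#V_5^*}\sum_{v}\exp\left(\frac{2\pi i\,(w,v)}{p}\right),$$ where $\mathrm{Disc}(s_0x^2+s_1xy+s_2y^2)=s_1^2-4s_0s_2$,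 and the second sum runs over the $v\in V_5^*$ that are singular, i.e. zero or with a multiple factor. The following values of $C(w)$ are attained, as $p$ ranges over the odd primes and $w$ over the elements of $V_5$ of the given Waring type, and each of them is attained by some $p$ and $w$ for which moreover $\widehat\Phi(w)=C(w)p^{-4}$: 1. every $c\in\{0,\pm1\}$ for Waring type $\langle1^3\rangle$; 2. every $c\in\{0,\pm1,-2,-3\}$ for Waring type $\langle1^2,1\rangle$; 3. every integer $c$ with $|c|\le4$ for Waring type $\langle1,1,1\rangle$. So no value can be removed from the lists $\{0,\pm1\}$, $\{0,\pm1,-2,-3\}$, $\{0,\pm1,\pm2,\pm3,\pm4\}$ of possible values of $C(w)$ for these three types, and the bound $|C(w)|\le4$ is sharp. Explicitly, the following $w$ have the stated Waring type and value of $C(w)$, and satisfy $\widehat\Phi(w)=C(w)p^{-4}$. * Type $\langle1^3\rangle$, $p=7$: $w=(x^2y^3)^*+(xy^4)^*+t(y^5)^*$ has $C(w)=0,-1,1$ for $t=-2,0,1$ respectively. * Type $\langle1^2,1\rangle$: $w=-(x^5)^*+(xy^4)^*+t(y^5)^*$ has $C(w)=-3,-2,-1,0,1$ for $(p,t)=(19,2),(7,3),(7,0),(11,4),(7,1)$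 respectively. * Type $\langle1,1,1\rangle$: $w=\alpha^{-2}(x^5)^*+\beta^{-2}(y^5)^*-\gamma^{-2}\sum_{i=0}^5(x^{5-i}y^i)^*$ has the following $C(w)$: | $p$ | $337$ | $13$ | $47$ | $11$ | $113$ | $41$ | $17$ | $7$ | $79$ | |---|---|---|---|---|---|---|---|---|---| | $(\alpha,\beta,\gamma)$ | $(1,2,3)$ | $(1,3,4)$ | $(1,2,3)$ | $(1,1,4)$ | $(1,2,3)$ | $(1,2,4)$ | $(1,2,3)$ | $(1,2,4)$ | $(1,2,3)$ | | $C(w)$ | $-4$ | $-3$ | $-2$ | $-1$ | $0$ | $1$ | $2$ | $3$ | $4$ | -/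

import Mathlib

/-- The space `V_n^*` of binary forms of degree `n` over `k` in the variables `x = X 0`, `y = X 1`:
homogeneous polynomials of degree `n` in two variables. -/
abbrev BinForm (k : Type*) [CommSemiring k] (n : ℕ) : Type _ :=
  MvPolynomial.homogeneousSubmodule (Fin 2) k n

/-- The space `V_n`, the dual of the space of binary forms of degree `n`. The natural pairing
`(w, v)` is the application `w v`. -/
abbrev DualBinForm (k : Type*) [CommSemiring k] (n : ℕ) : Type _ :=
  Module.Dual k (BinForm k n)

/-- There are finitely many binary forms of degree `n` over a finite ring. -/
instance instFiniteBinForm (k : Type*) [CommSemiring k] [Finite k] (n : ℕ) :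
    Finite (BinForm k n) := by
  classical
  have hfin : Set.Finite {d : Fin 2 →₀ ℕ | d.degree = n} := by
    refine Set.Finite.subset
      (Set.finite_Iic (Finsupp.equivFunOnFinite.symm (fun _ : Fin 2 => n))) ?_
    intro d hd i
    have hd' : d.degree = n := hd
    have := Finsupp.le_degree i d
    simp only [Finsupp.equivFunOnFinite_symm_apply_apply]
    omega
  have : Finite {d : Fin 2 →₀ ℕ | d.degree = n} := hfin
  refine Finite.of_injective
    (fun (v : BinForm k n) (d : {d : Fin 2 →₀ ℕ | d.degree = n}) =>
      MvPolynomial.coeff d.1 (v : MvPolynomial (Fin 2) k)) ?_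
  intro v w h
  apply Subtype.ext
  apply MvPolynomial.ext
  intro d
  by_cases hd : d.degree = n
  · exact congrFun h ⟨d, hd⟩
  · have hv : (v : MvPolynomial (Fin 2) k).IsHomogeneous n := v.2
    have hw : (w : MvPolynomial (Fin 2) k).IsHomogeneous n := w.2
    rw [hv.coeff_eq_zero hd, hw.coeff_eq_zero hd]

/-- The exponent of the monomial `x ^ (n - i) * y ^ i`. -/
noncomputable def monoExp (n i : ℕ) : Fin 2 →₀ ℕ :=
  Finsupp.single 0 (n - i) + Finsupp.single 1 i

/-- The coefficient of `x ^ (n - i) * y ^ i`, as a linear functional on forms of degree `n`: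
for `i ≤ n` this is the element `(x ^ (n - i) y ^ i)^*` of the dual basis. -/
noncomputable def dualMono (k : Type*) [CommSemiring k] (n i : ℕ) : DualBinForm k n :=
  (MvPolynomial.lcoeff k (monoExp n i)).comp (Submodule.subtype _)

/-- `a 0 (x ^ n)^* + a 1 (x ^ (n - 1) y)^* + ⋯ + a n (y ^ n)^*`. -/
noncomputable def dualForm {k : Type*} [CommSemiring k] {n : ℕ} (a : Fin (n + 1) → k) :
    DualBinForm k n :=
  ∑ i : Fin (n + 1), a i • dualMono k n i

/-- Multiplication of binary forms `V_m^* × V_d^* → V_n^*` for `m + d = n`. -/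
noncomputable def mulForm {k : Type*} [CommSemiring k] {m d n : ℕ} (h : m + d = n)
    (v : BinForm k m) (u : BinForm k d) : BinForm k n :=
  ⟨(v : MvPolynomial (Fin 2) k) * u, h ▸ MvPolynomial.IsHomogeneous.mul v.2 u.2⟩

/-- `v ∈ w^⊥`: the polar pairing `(w, v) ∈ V_{n-m}`, i.e. the functional `u ↦ (w, v * u)` on
`V_{n-m}^*`, vanishes. For `m > n` the space `V_{n-m}` is zero and the condition is empty. -/
def IsApolar {k : Type*} [CommSemiring k] {n m : ℕ} (w : DualBinForm k n) (v : BinForm k m) :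
    Prop :=
  ∀ (d : ℕ) (h : m + d = n) (u : BinForm k d), w (mulForm h v u) = 0

/-- A binary form is singular if it has a multiple factor (the zero form is singular). -/
def IsSingularForm {k : Type*} [CommSemiring k] {n : ℕ} (v : BinForm k n) : Prop :=
  ¬ Squarefree (v : MvPolynomial (Fin 2) k)

/-- `f` has splitting type `T`: `f = f_1 ^ e_1 ⋯ f_r ^ e_r` up to a unit, with pairwise
non-associated irreducible `f_i` of degree `d_i` and `e_i > 0`, and `T` is the multiset of the
pairs `(d_i, e_i)`. -/
def HasSplittingType {k : Type*} [CommSemiring k] {n : ℕ} (f : BinForm k n)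
    (T : Multiset (ℕ × ℕ)) : Prop :=
  ∃ (r : ℕ) (g : Fin r → MvPolynomial (Fin 2) k) (e : Fin r → ℕ),
    (∀ i, Irreducible (g i)) ∧ (∀ i j, i ≠ j → ¬ Associated (g i) (g j)) ∧ (∀ i, 0 < e i) ∧
    Associated (f : MvPolynomial (Fin 2) k) (∏ i, g i ^ e i) ∧
    T = Finset.univ.val.map (fun i : Fin r => ((g i).totalDegree, e i))

/-- `φ` is a minimal generator of the apolar ideal of `w`: a nonzero form of least degree
in `w^⊥`. (If `w ≠ 0` has odd degree, `φ` is unique up to a scalar.) -/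
def IsMinimalApolar {k : Type*} [CommSemiring k] {n s : ℕ} (w : DualBinForm k n)
    (φ : BinForm k s) : Prop :=
  φ ≠ 0 ∧ IsApolar w φ ∧ ∀ r < s, ∀ ψ : BinForm k r, IsApolar w ψ → ψ = 0

/-- The Waring type of `w` (of odd degree) is `T`: the minimal generator of the apolar ideal
has splitting type `T`. -/
def HasWaringType {k : Type*} [CommSemiring k] {n : ℕ} (w : DualBinForm k n)
    (T : Multiset (ℕ × ℕ)) : Prop :=
  ∃ (s : ℕ) (φ : BinForm k s), IsMinimalApolar w φ ∧ HasSplittingType φ T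

/-- The discriminant `s₁² - 4 s₀ s₂` of the binary quadratic form `s₀ x² + s₁ x y + s₂ y²`. -/
noncomputable def quadDisc {k : Type*} [CommRing k] (f : BinForm k 2) : k :=
  dualMono k 2 1 f ^ 2 - 4 * dualMono k 2 0 f * dualMono k 2 2 f

/-- `C(w) = - ∑ (Disc f / p)`, the sum over all `[f] ∈ P(V_2^*)` with `f ^ 2 ∈ w^⊥`. Neither the
condition nor the summand depends on the representative of `[f]`. -/
noncomputable def quinticC {p : ℕ} [Fact p.Prime] (w : DualBinForm (ZMod p) 5) : ℤ :=
  - ∑ᶠ f ∈ {f : Projectivization (ZMod p) (BinForm (ZMod p) 2) |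
        IsApolar w (mulForm (rfl : 2 + 2 = 4) f.rep f.rep)},
      quadraticChar (ZMod p) (quadDisc f.rep)

/-- The exponential sum of singular binary forms of degree `n` over `𝔽_p`. -/
noncomputable def expSum {p n : ℕ} (w : DualBinForm (ZMod p) n) : ℂ :=
  (1 / (Nat.card (BinForm (ZMod p) n) : ℂ)) *
    ∑ᶠ v ∈ {v : BinForm (ZMod p) n | IsSingularForm v},
      Complex.exp (2 * Real.pi * Complex.I * ((w v).val : ℂ) / (p : ℂ))

/-- `p` is an odd prime, and `w` is an element of `V_5` over `𝔽_p` of Waring type `T` with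
`C(w) = c`, where `C(w)` also governs the exponential sum, which equals `C(w) p ^ (-4)`. -/
def Realizes (p : ℕ) (w : DualBinForm (ZMod p) 5) (T : Multiset (ℕ × ℕ)) (c : ℤ) : Prop :=
  ∃ _ : Fact p.Prime, 2 < p ∧ HasWaringType w T ∧ quinticC w = c ∧
    expSum w = (quinticC w : ℂ) / (p : ℂ) ^ 4

/-- The Waring type `⟨1³⟩`. -/
def typeCube : Multiset (ℕ × ℕ) := {(1, 3)}

/-- The Waring type `⟨1², 1⟩`. -/
def typeSquareLine : Multiset (ℕ × ℕ) := {(1, 2), (1, 1)}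

/-- The Waring type `⟨1, 1, 1⟩`. -/
def typeThreeLines : Multiset (ℕ × ℕ) := {(1, 1), (1, 1), (1, 1)}

/-- The element `α⁻² (x⁵)^* + β⁻² (y⁵)^* - γ⁻² ((x⁵)^* + (x⁴y)^* + ⋯ + (y⁵)^*)` of `V_5`
over `𝔽_p`. -/
noncomputable def threeLineQuintic (p : ℕ) (α β γ : ZMod p) : DualBinForm (ZMod p) 5 :=
  (α⁻¹ ^ 2) • dualForm ![1, 0, 0, 0, 0, 0] + (β⁻¹ ^ 2) • dualForm ![0, 0, 0, 0, 0, 1]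
    - (γ⁻¹ ^ 2) • dualForm ![1, 1, 1, 1, 1, 1]

open MvPolynomial

/-! ### Coordinates on binary forms -/

section Coordinates

variable {k : Type*} [CommSemiring k] {m d n : ℕ}

/-! Let χ be the quadratic character of a field with q elements, q odd. The main point is an
inclusion-exclusion for quintics v: (q - 1)·[v singular] equals the number of linear l ≠ 0 with l² ∣
v, minus the sum of χ(Disc f) over quadratic f ≠ 0 with f² ∣ v (`singular_indicator`). Indeed a
quadratic form f ≠ 0 has 1 + χ(Disc f) rational roots up to scalars, so if v = f²h ≠ 0 the linear
count is (q - 1)(1 + χ(Disc f)), and the second sum removes the excess.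

The Fourier transform is then taken term by term. The quintics divisible by g² form the space
g²·V_d^*, on which the character v ↦ ψ((w, v)) sums to the size of the space if g² ∈ w^⊥ and to 0
otherwise (`sum_sq_dvd`). If w^⊥ contains no nonzero quadratic form, every linear term dies and the
quadratic terms add up to p²(p - 1)C(w). Division by (p - 1)p⁶ gives C(w)p⁻⁴ (`expSum_eq_quinticC`).

It remains to compute C(w). The condition f² ∈ w^⊥ is a pair of quadratic equations in the three
coefficients of f, that is, an intersection of two conics. In `realizes_cube`, `realizes_squareLine`
and `realizes_threeLines` it is solved explicitly, with 2, 3 and 4 points. So C(w) is minus a sum of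
Jacobi symbols in the parameters, which is evaluated at the listed primes. The Waring type is read
off the cubic x³, x²y or xy(x - y) in w^⊥, which has least degree because no quadratic form is
apolar to w (`hasWaringType_of_cubic`). -/

lemma degree_monoExp {i : ℕ} (hi : i ≤ n) : (monoExp n i).degree = n := by
  simp [monoExp, Finsupp.degree_eq_sum, hi]

lemma monoExp_add {i j : ℕ} (hi : i ≤ m) (hj : j ≤ d) :
    monoExp m i + monoExp d j = monoExp (m + d) (i + j) := by
  ext l
  fin_cases l
  · simp [monoExp]; omega
  · simp [monoExp]

lemma monoExp_inj {i j : ℕ} : monoExp n i = monoExp n j ↔ i = j := by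
  refine ⟨fun h => ?_, fun h => h ▸ rfl⟩
  simpa [monoExp] using DFunLike.congr_fun h 1

lemma eq_monoExp_of_degree {e : Fin 2 →₀ ℕ} (he : e.degree = n) : e = monoExp n (e 1) := by
  rw [Finsupp.degree_eq_sum, Fin.sum_univ_two] at he
  ext l
  fin_cases l
  · simp [monoExp]; omega
  · simp [monoExp]

/-- The binary form `a 0 x ^ n + a 1 x ^ (n - 1) y + ⋯ + a n y ^ n`. -/
noncomputable def binForm (a : Fin (n + 1) → k) : BinForm k n :=
  ⟨∑ i : Fin (n + 1), monomial (monoExp n i) (a i),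
    IsHomogeneous.sum _ _ _ fun i _ =>
      isHomogeneous_monomial _ (degree_monoExp (Nat.lt_succ_iff.1 i.2))⟩

lemma coe_binForm (a : Fin (n + 1) → k) : (binForm a : MvPolynomial (Fin 2) k) =
    ∑ i : Fin (n + 1), monomial (monoExp n i) (a i) := rfl

lemma dualMono_apply (i : ℕ) (v : BinForm k n) :
    dualMono k n i v = coeff (monoExp n i) (v : MvPolynomial (Fin 2) k) := rfl

@[simp]
lemma dualMono_binForm (a : Fin (n + 1) → k) (i : Fin (n + 1)) :
    dualMono k n i (binForm a) = a i := by
  rw [dualMono_apply, coe_binForm, coeff_sum, Finset.sum_eq_single i]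
  · simp
  · intro j _ hj
    rw [coeff_monomial, if_neg]
    rw [monoExp_inj]
    exact fun h => hj (Fin.ext h)
  · simp

lemma binForm_ext {v u : BinForm k n}
    (h : ∀ i : Fin (n + 1), dualMono k n i v = dualMono k n i u) : v = u := by
  apply Subtype.ext
  apply MvPolynomial.ext
  intro e
  by_cases he : e.degree = n
  · have hlt : e 1 < n + 1 := by
      rw [Finsupp.degree_eq_sum, Fin.sum_univ_two] at he
      omega
    rw [eq_monoExp_of_degree he]
    exact h ⟨e 1, hlt⟩
  · have hv : (v : MvPolynomial (Fin 2) k).IsHomogeneous n := v.2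
    have hu : (u : MvPolynomial (Fin 2) k).IsHomogeneous n := u.2
    rw [hv.coeff_eq_zero he, hu.coeff_eq_zero he]

/-- The coefficients identify binary forms of degree `n` with vectors of length `n + 1`. -/
noncomputable def binFormEquiv (k : Type*) [CommSemiring k] (n : ℕ) :
    (Fin (n + 1) → k) ≃ BinForm k n where
  toFun := binForm
  invFun := fun v i => dualMono k n i v
  left_inv a := funext fun i => dualMono_binForm a i
  right_inv _ := binForm_ext fun i => dualMono_binForm _ i

lemma exists_eq_binForm (v : BinForm k n) : ∃ a, v = binForm a :=
  ⟨_, ((binFormEquiv k n).right_inv v).symm⟩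

lemma binForm_injective : Function.Injective (binForm : (Fin (n + 1) → k) → BinForm k n) :=
  (binFormEquiv k n).injective

lemma binForm_inj {a b : Fin (n + 1) → k} : binForm a = binForm b ↔ a = b :=
  binForm_injective.eq_iff

@[simp]
lemma binForm_zero : binForm (0 : Fin (n + 1) → k) = 0 :=
  binForm_ext fun i => by simp

lemma binForm_eq_zero {a : Fin (n + 1) → k} : binForm a = 0 ↔ a = 0 := by
  rw [← binForm_zero, binForm_inj]

lemma smul_binForm (c : k) (a : Fin (n + 1) → k) : c • binForm a = binForm (c • a) :=
  binForm_ext fun i => by simp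

@[simp]
lemma coe_mulForm (h : m + d = n) (v : BinForm k m) (u : BinForm k d) :
    (mulForm h v u : MvPolynomial (Fin 2) k) = v * u := rfl

lemma coe_mulForm_binForm (a : Fin (m + 1) → k) (b : Fin (d + 1) → k) :
    (binForm a * binForm b : MvPolynomial (Fin 2) k) =
      ∑ i : Fin (m + 1), ∑ j : Fin (d + 1), monomial (monoExp (m + d) (i + j)) (a i * b j) := by
  simp only [coe_binForm, Finset.sum_mul_sum, monomial_mul]
  refine Finset.sum_congr rfl fun i _ => Finset.sum_congr rfl fun j _ => ?_
  rw [monoExp_add (Nat.lt_succ_iff.1 i.2) (Nat.lt_succ_iff.1 j.2)]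

lemma dualMono_mulForm (h : m + d = n) (a : Fin (m + 1) → k) (b : Fin (d + 1) → k) (l : ℕ) :
    dualMono k n l (mulForm h (binForm a) (binForm b)) =
      ∑ i : Fin (m + 1), ∑ j : Fin (d + 1), if (i + j : ℕ) = l then a i * b j else 0 := by
  subst h
  simp only [dualMono_apply, coe_mulForm, coe_mulForm_binForm, coeff_sum, coeff_monomial,
    monoExp_inj]

lemma dualForm_mulForm (h : m + d = n) (c : Fin (n + 1) → k) (a : Fin (m + 1) → k)
    (b : Fin (d + 1) → k) :
    dualForm c (mulForm h (binForm a) (binForm b)) =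
      ∑ j : Fin (d + 1), (∑ i : Fin (m + 1), a i * c ⟨i + j, by omega⟩) * b j := by
  simp only [dualForm, LinearMap.sum_apply, LinearMap.smul_apply, dualMono_mulForm, smul_eq_mul,
    Finset.mul_sum, Finset.sum_mul]
  rw [Finset.sum_comm, Finset.sum_comm (s := Finset.univ (α := Fin (d + 1)))]
  refine Finset.sum_congr rfl fun i _ => ?_
  rw [Finset.sum_comm]
  refine Finset.sum_congr rfl fun j _ => ?_
  rw [Finset.sum_eq_single (⟨i + j, by omega⟩ : Fin (n + 1))]
  · simp only [if_true]
    ring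
  · intro l _ hl
    rw [if_neg, mul_zero]
    exact fun h => hl (Fin.ext h.symm)
  · simp

/-- Testing against the monomials of degree d suffices, which turns apolarity into a Hankel
(catalecticant) linear system. -/
lemma isApolar_dualForm_iff (h : m + d = n) (c : Fin (n + 1) → k) (a : Fin (m + 1) → k) :
    IsApolar (dualForm c) (binForm a) ↔
      ∀ j : Fin (d + 1), ∑ i : Fin (m + 1), a i * c ⟨i + j, by omega⟩ = 0 := by
  constructor
  · intro H j
    have := H d h (binForm (Pi.single j 1))
    rw [dualForm_mulForm, Finset.sum_eq_single j] at this
    · simpa using this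
    · intro i _ hi
      simp [hi]
    · simp
  · intro H d' h' u
    obtain rfl : d = d' := by omega
    obtain ⟨b, rfl⟩ := exists_eq_binForm u
    rw [dualForm_mulForm]
    exact Finset.sum_eq_zero fun j _ => by rw [H j, zero_mul]

lemma mulForm_linear_linear (s t a b : k) :
    mulForm (rfl : 1 + 1 = 2) (binForm ![s, t]) (binForm ![a, b]) =
      binForm ![s * a, s * b + t * a, t * b] := by
  refine binForm_ext fun l => ?_
  rw [dualMono_mulForm, dualMono_binForm]
  fin_cases l <;> simp [Fin.sum_univ_succ]

lemma mulForm_quadratic_self (a b c : k) :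
    mulForm (rfl : 2 + 2 = 4) (binForm ![a, b, c]) (binForm ![a, b, c]) =
      binForm ![a * a, 2 * (a * b), 2 * (a * c) + b * b, 2 * (b * c), c * c] := by
  refine binForm_ext fun l => ?_
  rw [dualMono_mulForm, dualMono_binForm]
  fin_cases l <;> simp [Fin.sum_univ_succ] <;> ring

lemma smul_mulForm (h : m + d = n) (c : k) (v : BinForm k m) (u : BinForm k d) :
    mulForm h (c • v) u = c • mulForm h v u :=
  Subtype.ext (by simp)

lemma mulForm_smul (h : m + d = n) (c : k) (v : BinForm k m) (u : BinForm k d) :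
    mulForm h v (c • u) = c • mulForm h v u :=
  Subtype.ext (by simp)

lemma IsApolar.smul {w : DualBinForm k n} {v : BinForm k m} (hv : IsApolar w v) (c : k) :
    IsApolar w (c • v) := fun d h u => by
  rw [smul_mulForm, map_smul, hv d h u, smul_zero]

end Coordinates

lemma quadDisc_binForm {k : Type*} [CommRing k] (a : Fin 3 → k) :
    quadDisc (binForm a : BinForm k 2) = a 1 ^ 2 - 4 * a 0 * a 2 := by
  have h0 := dualMono_binForm (n := 2) a 0
  have h1 := dualMono_binForm (n := 2) a 1
  have h2 := dualMono_binForm (n := 2) a 2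
  simp only [Fin.val_zero, Fin.val_one, Fin.val_two] at h0 h1 h2
  rw [quadDisc, h0, h1, h2]

lemma quadDisc_smul {k : Type*} [CommRing k] (c : k) (f : BinForm k 2) :
    quadDisc (c • f) = c ^ 2 * quadDisc f := by
  simp only [quadDisc, map_smul, smul_eq_mul]
  ring

/-! ### Divisors of homogeneous polynomials -/

section Homogeneous

variable {σ K : Type*} [Field K]

lemma MvPolynomial.le_order_toMvPowerSeries {f : MvPolynomial σ K} {n : ℕ}
    (hf : f.IsHomogeneous n) : (n : ℕ∞) ≤ (f : MvPowerSeries σ K).order :=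
  MvPowerSeries.le_order fun d hd => by
    rw [coeff_coe]
    exact hf.coeff_eq_zero (by exact_mod_cast hd.ne)

lemma MvPolynomial.order_le_degree {f : MvPolynomial σ K} {d : σ →₀ ℕ} (hd : d ∈ f.support) :
    (f : MvPowerSeries σ K).order ≤ d.degree :=
  MvPowerSeries.order_le (by rw [coeff_coe]; exact mem_support_iff.1 hd)

lemma MvPolynomial.order_le_totalDegree {f : MvPolynomial σ K} (hf : f ≠ 0) :
    (f : MvPowerSeries σ K).order ≤ f.totalDegree := by
  obtain ⟨d, hd⟩ := support_nonempty.2 hf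
  refine (order_le_degree hd).trans ?_
  exact_mod_cast le_totalDegree hd

/-- The order as a power series is the lowest degree of a monomial that occurs, and the total degree
is the highest. -/
lemma MvPolynomial.isHomogeneous_of_totalDegree_le_order {f : MvPolynomial σ K}
    (hf : (f.totalDegree : ℕ∞) ≤ (f : MvPowerSeries σ K).order) :
    f.IsHomogeneous f.totalDegree := by
  intro d hd
  have hd' := mem_support_iff.2 hd
  have h1 : d.degree ≤ f.totalDegree := le_totalDegree hd'
  have h2 : f.totalDegree ≤ d.degree := by exact_mod_cast hf.trans (order_le_degree hd')
  exact (DFunLike.congr_fun (Finsupp.degree_eq_weight_one (R := ℕ)) d).symm.trans (le_antisymm h1 h2)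

/-- A divisor of a nonzero homogeneous polynomial is homogeneous. -/
lemma MvPolynomial.IsHomogeneous.of_dvd {f g : MvPolynomial σ K} {n : ℕ}
    (hg : g.IsHomogeneous n) (hg0 : g ≠ 0) (hfg : f ∣ g) : f.IsHomogeneous f.totalDegree := by
  obtain ⟨h, rfl⟩ := hfg
  have hf0 := left_ne_zero_of_mul hg0
  have hh0 := right_ne_zero_of_mul hg0
  -- Order and total degree are both additive on products, and order ≤ degree for each factor;
  -- equality for the product forces equality for both factors.
  apply isHomogeneous_of_totalDegree_le_order
  have hdeg := hg.totalDegree hg0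
  rw [totalDegree_mul_of_isDomain hf0 hh0] at hdeg
  have hord := le_order_toMvPowerSeries hg
  rw [coe_mul, MvPowerSeries.order_mul, ← hdeg] at hord
  have h1 := order_le_totalDegree hf0
  have h2 := order_le_totalDegree hh0
  push_cast at hord
  lift (f : MvPowerSeries σ K).order to ℕ using ne_top_of_le_ne_top (ENat.natCast_ne_top _) h1 with x
  lift (h : MvPowerSeries σ K).order to ℕ using ne_top_of_le_ne_top (ENat.natCast_ne_top _) h2 with y
  norm_cast at *
  omega

variable {m d n : ℕ}

lemma coe_ne_zero_of_ne_zero {v : BinForm K n} (hv : v ≠ 0) :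
    (v : MvPolynomial (Fin 2) K) ≠ 0 := fun h => hv (Subtype.ext h)

/-- The cofactor of a form in a form is again a form, so divisibility of polynomials can be tested
inside the finite-dimensional spaces of forms. -/
lemma coe_dvd_coe_iff (h : m + d = n) {v : BinForm K m} (hv : v ≠ 0) {u : BinForm K n} :
    (v : MvPolynomial (Fin 2) K) ∣ u ↔ ∃ q : BinForm K d, mulForm h v q = u := by
  constructor
  · rintro ⟨q, hq⟩
    by_cases hu : u = 0
    · exact ⟨0, Subtype.ext (by simp [hu])⟩
    have hu' := coe_ne_zero_of_ne_zero hu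
    have hv' := coe_ne_zero_of_ne_zero hv
    have hq0 : q ≠ 0 := by
      rintro rfl
      exact hu' (by rw [hq, mul_zero])
    have hhom := IsHomogeneous.of_dvd u.2 hu' ⟨v, by rw [hq, mul_comm]⟩
    have hdeg := IsHomogeneous.totalDegree u.2 hu'
    rw [hq, totalDegree_mul_of_isDomain hv' hq0, IsHomogeneous.totalDegree v.2 hv'] at hdeg
    obtain rfl : q.totalDegree = d := by omega
    exact ⟨⟨q, hhom⟩, Subtype.ext hq.symm⟩
  · rintro ⟨q, rfl⟩
    exact ⟨q, rfl⟩

lemma isUnit_coe_of_degree_zero {v : BinForm K 0} (hv : v ≠ 0) :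
    IsUnit (v : MvPolynomial (Fin 2) K) := by
  have h := (totalDegree_eq_zero_iff_eq_C).1 (Nat.le_zero.1 (IsHomogeneous.totalDegree_le v.2))
  rw [h]
  refine IsUnit.map C (isUnit_iff_ne_zero.2 fun h0 => coe_ne_zero_of_ne_zero hv ?_)
  rw [h, h0, C_0]

lemma not_isUnit_coe {v : BinForm K n} (hn : n ≠ 0) : ¬ IsUnit (v : MvPolynomial (Fin 2) K) := by
  intro h
  have h0 : (v : MvPolynomial (Fin 2) K) ≠ 0 := h.ne_zero
  have h1 := IsHomogeneous.totalDegree v.2 h0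
  rw [(isUnit_iff_totalDegree_of_isReduced.1 h).2] at h1
  exact hn h1.symm

lemma irreducible_coe_of_degree_one {v : BinForm K 1} (hv : v ≠ 0) :
    Irreducible (v : MvPolynomial (Fin 2) K) := by
  have hv' := coe_ne_zero_of_ne_zero hv
  refine irreducible_of_totalDegree_eq_one (IsHomogeneous.totalDegree v.2 hv') fun x hx => ?_
  rw [isUnit_iff_ne_zero]
  rintro rfl
  refine hv' (MvPolynomial.ext _ _ fun e => ?_)
  simpa using hx e

end Homogeneous

/-! ### Quadratic forms over a finite field -/

section Quadratic

variable {K : Type*} [Field K]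

/-- The right-hand side is the value of the quadratic form at the zero (l 1, -l 0) of the linear
form. -/
lemma linear_dvd_quadratic_iff {l : Fin 2 → K} (hl : l ≠ 0) (f : Fin 3 → K) :
    (binForm l : MvPolynomial (Fin 2) K) ∣ (binForm f : BinForm K 2) ↔
      f 0 * l 1 ^ 2 - f 1 * l 0 * l 1 + f 2 * l 0 ^ 2 = 0 := by
  rw [coe_dvd_coe_iff (rfl : 1 + 1 = 2) (fun h => hl (binForm_eq_zero.1 h))]
  have key (u : Fin 2 → K) : mulForm (rfl : 1 + 1 = 2) (binForm l) (binForm u) = binForm f ↔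
      l 0 * u 0 = f 0 ∧ l 0 * u 1 + l 1 * u 0 = f 1 ∧ l 1 * u 1 = f 2 := by
    have hl : l = ![l 0, l 1] := by ext i; fin_cases i <;> rfl
    have hu : u = ![u 0, u 1] := by ext i; fin_cases i <;> rfl
    rw [hl, hu, mulForm_linear_linear, binForm_inj, funext_iff]
    simp [Fin.forall_fin_succ]
  constructor
  · rintro ⟨u, hu⟩
    obtain ⟨u, rfl⟩ := exists_eq_binForm u
    obtain ⟨h0, h1, h2⟩ := (key u).1 hu
    rw [← h0, ← h1, ← h2]
    ring
  · intro h
    by_cases h0 : l 0 = 0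
    · have h1 : l 1 ≠ 0 := fun h1 => hl (by ext i; fin_cases i <;> assumption)
      have hf : f 0 = 0 := by simpa [h0, h1] using h
      refine ⟨binForm ![f 1 / l 1, f 2 / l 1], (key _).2 ⟨?_, ?_, ?_⟩⟩
      · simp [h0, hf]
      · simp [h0]
        field_simp
      · simp
        field_simp
    · refine ⟨binForm ![f 0 / l 0, (f 1 - l 1 * (f 0 / l 0)) / l 0], (key _).2 ⟨?_, ?_, ?_⟩⟩
      · simp
        field_simp
      · simp
        field_simp
        ring
      · simp
        field_simp
        linear_combination -h

variable [Fintype K] [DecidableEq K]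

lemma sum_ite_eq_zero (A B : ℤ) :
    ∑ x : K, (if x = 0 then A else B) = A + (Fintype.card K - 1) * B := by
  rw [← Finset.add_sum_erase _ _ (Finset.mem_univ 0), if_pos rfl,
    Finset.sum_congr rfl (fun x hx => if_neg (Finset.ne_of_mem_erase hx)), Finset.sum_const,
    Finset.card_erase_of_mem (Finset.mem_univ _), Finset.card_univ, nsmul_eq_mul,
    Nat.cast_sub Fintype.card_pos, Nat.cast_one]

lemma card_sq_eq (hK : ringChar K ≠ 2) (a : K) :
    ((Finset.univ.filter fun x : K => x ^ 2 = a).card : ℤ) = quadraticChar K a + 1 := by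
  rw [← quadraticChar_card_sqrts hK]
  congr 2
  ext
  simp

/-- The number of nonzero vectors on which a nonzero binary quadratic form vanishes. -/
lemma card_isotropic (hK : ringChar K ≠ 2) {a b c : K} (h : ¬ (a = 0 ∧ b = 0 ∧ c = 0)) :
    ((Finset.univ.filter fun z : K × K => z ≠ 0 ∧
        a * z.2 ^ 2 - b * z.1 * z.2 + c * z.1 ^ 2 = 0).card : ℤ) =
      (Fintype.card K - 1) * (1 + quadraticChar K (b ^ 2 - 4 * a * c)) := by
  have h2 : (2 : K) ≠ 0 := Ring.two_ne_zero hK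
  have hsum (P : K × K → Prop) [DecidablePred P] : ((Finset.univ.filter P).card : ℤ) =
      ∑ x : K, ((Finset.univ.filter fun y => P (x, y)).card : ℤ) := by
    simp only [Finset.card_filter, Nat.cast_sum]
    rw [Fintype.sum_prod_type]
  rw [hsum]
  by_cases ha : a = 0
  · subst ha
    by_cases hb : b = 0
    · subst hb
      have hc : c ≠ 0 := fun hc => h ⟨rfl, rfl, hc⟩
      have (x : K) : ((Finset.univ.filter fun y : K => (x, y) ≠ 0 ∧
          0 * y ^ 2 - 0 * x * y + c * x ^ 2 = 0).card : ℤ) =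
          if x = 0 then (Fintype.card K - 1 : ℤ) else 0 := by
        split_ifs with hx
        · subst hx
          simp [Finset.filter_ne', Finset.card_erase_of_mem, Finset.card_univ,
            Nat.cast_sub Fintype.card_pos]
        · simp [hx, hc]
      simp only [this, sum_ite_eq_zero]
      simp
    · have (x : K) : ((Finset.univ.filter fun y : K => (x, y) ≠ 0 ∧
          0 * y ^ 2 - b * x * y + c * x ^ 2 = 0).card : ℤ) =
          if x = 0 then (Fintype.card K - 1 : ℤ) else 1 := by
        split_ifs with hx
        · subst hx
          simp [Finset.filter_ne', Finset.card_erase_of_mem, Finset.card_univ,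
            Nat.cast_sub Fintype.card_pos]
        · have : (Finset.univ.filter fun y : K => (x, y) ≠ 0 ∧
            0 * y ^ 2 - b * x * y + c * x ^ 2 = 0) = {c * x / b} := by
            ext y
            simp only [Finset.mem_filter, Finset.mem_univ, true_and, Finset.mem_singleton]
            constructor
            · rintro ⟨-, h⟩
              rw [eq_div_iff hb]
              apply mul_left_cancel₀ hx
              linear_combination -h
            · rintro rfl
              refine ⟨by simp [hx], ?_⟩
              field_simp
              ring
          rw [this]
          simp
      simp only [this, sum_ite_eq_zero]
      have : b ^ 2 - 4 * 0 * c = b ^ 2 := by ring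
      rw [this, quadraticChar_sq_one' hb]
      ring
  · have (x : K) : ((Finset.univ.filter fun y : K => (x, y) ≠ 0 ∧
        a * y ^ 2 - b * x * y + c * x ^ 2 = 0).card : ℤ) =
        if x = 0 then 0 else 1 + quadraticChar K (b ^ 2 - 4 * a * c) := by
      split_ifs with hx
      · subst hx
        simp [ha]
      -- Completing the square: with z = 2ay - bx the equation becomes z² = (b² - 4ac)x², and x² ≠ 0
      -- does not change the character.
      · have hD : quadraticChar K (b ^ 2 - 4 * a * c) =
            quadraticChar K ((b ^ 2 - 4 * a * c) * x ^ 2) := by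
          rw [map_mul, quadraticChar_sq_one' hx, mul_one]
        rw [hD, add_comm, ← card_sq_eq hK]
        congr 1
        refine Finset.card_bij' (fun y _ => 2 * a * y - b * x) (fun z _ => (z + b * x) / (2 * a))
          ?_ ?_ ?_ ?_
        · simp only [Finset.mem_filter, Finset.mem_univ, true_and]
          rintro y ⟨-, hy⟩
          linear_combination 4 * a * hy
        · simp only [Finset.mem_filter, Finset.mem_univ, true_and]
          intro z hz
          refine ⟨by simp [hx], ?_⟩
          field_simp
          linear_combination hz
        · intro y _
          field_simp
          ring
        · intro z _
          field_simp
          ring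
    simp only [this, sum_ite_eq_zero, zero_add]

/-- The sum of the quadratic character over the discriminants of all binary quadratic forms. -/
lemma sum_quadraticChar_disc (hK : ringChar K ≠ 2) :
    ∑ z : K × K × K, quadraticChar K (z.2.1 ^ 2 - 4 * z.1 * z.2.2) =
      Fintype.card K * (Fintype.card K - 1 : ℤ) := by
  have h4 : (4 : K) ≠ 0 := by
    have : (4 : K) = 2 * 2 := by norm_num
    rw [this]
    exact mul_ne_zero (Ring.two_ne_zero hK) (Ring.two_ne_zero hK)
  rw [Fintype.sum_prod_type, ← Finset.add_sum_erase _ _ (Finset.mem_univ 0)]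
  have hzero : ∑ z : K × K, quadraticChar K (z.1 ^ 2 - 4 * 0 * z.2) =
      Fintype.card K * (Fintype.card K - 1 : ℤ) := by
    have (x : K) : ∑ y : K, quadraticChar K (x ^ 2 - 4 * 0 * y) =
        if x = 0 then 0 else (Fintype.card K : ℤ) := by
      split_ifs with hx
      · simp [hx]
      · simp only [mul_zero, zero_mul, sub_zero, quadraticChar_sq_one' hx]
        simp
    simp only [Fintype.sum_prod_type, this, sum_ite_eq_zero]
    ring
  -- Only the slice a = 0 contributes: for a ≠ 0 and fixed b, the map c ↦ b² - 4ac is a bijection of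
  -- K, over which the character sums to zero.
  rw [hzero, Finset.sum_eq_zero, add_zero]
  intro a ha
  rw [Fintype.sum_prod_type]
  refine Finset.sum_eq_zero fun b _ => ?_
  rw [← quadraticChar_sum_zero hK]
  have h4a : -(4 * a) ≠ 0 := neg_ne_zero.2 (mul_ne_zero h4 (Finset.ne_of_mem_erase ha))
  refine Fintype.sum_equiv ((Equiv.mulLeft₀ (-(4 * a)) h4a).trans (Equiv.addRight (b ^ 2))) _ _
    fun c => ?_
  change _ = quadraticChar K (-(4 * a) * c + b ^ 2)
  congr 1
  ring

end Quadratic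

/-- After cancelling the common factor d of a and b, the rest a' of a is coprime to that of b, so
a'² divides the squarefree c and a' is a unit. -/
lemma dvd_of_sq_dvd_sq_mul {R : Type*} [CommRing R] [IsDomain R] [UniqueFactorizationMonoid R]
    {a b c : R} (hb : b ≠ 0) (hc : Squarefree c) (h : a * a ∣ b * b * c) : a ∣ b := by
  obtain ⟨a', b', d, hrel, rfl, rfl⟩ :=
    UniqueFactorizationMonoid.exists_reduced_factors' a b hb
  have hd : d ≠ 0 := left_ne_zero_of_mul hb
  have h1 : a' * a' ∣ b' * b' * c := by
    refine (mul_dvd_mul_iff_left (mul_ne_zero hd hd)).1 ?_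
    convert h using 1 <;> ring
  have h2 : a' * a' ∣ c :=
    ((hrel.mul_left hrel).mul_right (hrel.mul_left hrel)).dvd_of_dvd_mul_left h1
  exact mul_dvd_mul_left d (hc a' h2).dvd

/-! ### Counting square divisors of binary quintic forms -/

section SquareDivisors

noncomputable instance instFintypeBinForm (k : Type*) [CommSemiring k] [Finite k] (n : ℕ) :
    Fintype (BinForm k n) := Fintype.ofFinite _

lemma card_binForm (k : Type*) [CommSemiring k] [Fintype k] (n : ℕ) :
    Fintype.card (BinForm k n) = Fintype.card k ^ (n + 1) := by
  rw [← Fintype.card_congr (binFormEquiv k n), Fintype.card_fun, Fintype.card_fin]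

/-- Linear forms in terms of their coefficients. -/
noncomputable def linearFormEquiv (k : Type*) [CommSemiring k] : k × k ≃ BinForm k 1 :=
  (finTwoArrowEquiv k).symm.trans (binFormEquiv k 1)

lemma linearFormEquiv_apply {k : Type*} [CommSemiring k] (z : k × k) :
    linearFormEquiv k z = binForm ![z.1, z.2] := rfl

/-- Quadratic forms in terms of their coefficients. -/
noncomputable def quadraticFormEquiv (k : Type*) [CommSemiring k] : k × k × k ≃ BinForm k 2 :=
  ((Equiv.refl k).prodCongr (finTwoArrowEquiv k).symm).trans
    ((Fin.consEquiv fun _ => k).trans (binFormEquiv k 2))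

lemma quadraticFormEquiv_apply {k : Type*} [CommSemiring k] (z : k × k × k) :
    quadraticFormEquiv k z = binForm ![z.1, z.2.1, z.2.2] := rfl

variable {K : Type*} [Field K]

lemma exists_smul_of_dvd {n : ℕ} {f g : BinForm K n} (hg : g ≠ 0)
    (h : (f : MvPolynomial (Fin 2) K) ∣ g) : ∃ c : Kˣ, f = c • g := by
  have hf : f ≠ 0 := by
    rintro rfl
    exact coe_ne_zero_of_ne_zero hg (zero_dvd_iff.1 h)
  obtain ⟨q, hq⟩ := (coe_dvd_coe_iff (add_zero n) hf).1 h
  obtain ⟨a, rfl⟩ := exists_eq_binForm q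
  have ha : (binForm a : MvPolynomial (Fin 2) K) = C (a 0) := by
    rw [coe_binForm]
    simp [monoExp]
  have hgf : a 0 • f = g := by
    rw [← hq]
    apply Subtype.ext
    rw [coe_mulForm, ha, mul_comm, ← smul_eq_C_mul]
    rfl
  have ha0 : a 0 ≠ 0 := by
    intro h0
    exact hg (by rw [← hgf, h0, zero_smul])
  refine ⟨(Units.mk0 _ ha0)⁻¹, ?_⟩
  rw [← hgf, Units.smul_def, smul_smul]
  simp [ha0]

lemma smul_dvd {n : ℕ} (c : Kˣ) (g : BinForm K n) :
    ((c • g : BinForm K n) : MvPolynomial (Fin 2) K) ∣ g := by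
  refine ⟨C (↑c⁻¹ : K), ?_⟩
  rw [Units.smul_def, mul_comm, ← smul_eq_C_mul]
  simp [smul_smul]

open Classical in
-- A divisor of g of the same degree is a nonzero scalar multiple of g, and there are q - 1 of
-- these.
lemma sum_divisors_of_same_degree [Fintype K] {n : ℕ} {g : BinForm K n} (hg : g ≠ 0) (G : BinForm K n → ℤ)
    (hG : ∀ c : Kˣ, G (c • g) = G g)
    [DecidablePred fun f : BinForm K n => f ≠ 0 ∧ (f : MvPolynomial (Fin 2) K) ∣ g] :
    ∑ f ∈ Finset.univ.filter fun f : BinForm K n => f ≠ 0 ∧ (f : MvPolynomial (Fin 2) K) ∣ g,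
        G f = (Fintype.card K - 1) * G g := by
  have : (Finset.univ.filter fun f : BinForm K n => f ≠ 0 ∧ (f : MvPolynomial (Fin 2) K) ∣ g) =
      Finset.univ.image fun c : Kˣ => c • g := by
    ext f
    simp only [Finset.mem_filter, Finset.mem_univ, true_and, Finset.mem_image]
    constructor
    · rintro ⟨-, h⟩
      obtain ⟨c, hc⟩ := exists_smul_of_dvd hg h
      exact ⟨c, hc.symm⟩
    · rintro ⟨c, rfl⟩
      exact ⟨(smul_ne_zero_iff_ne c).2 hg, smul_dvd c g⟩
  rw [this, Finset.sum_image]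
  · simp only [hG, Finset.sum_const, Finset.card_univ, Fintype.card_units, nsmul_eq_mul]
    rw [Nat.cast_sub Fintype.card_pos, Nat.cast_one]
  · intro c _ c' _ h
    apply Units.ext
    exact smul_left_injective K hg h

open Classical in
lemma card_linear_divisors [Fintype K] [DecidableEq K] (hK : ringChar K ≠ 2) {f : BinForm K 2} (hf : f ≠ 0) :
    ∑ _l ∈ Finset.univ.filter fun l : BinForm K 1 => l ≠ 0 ∧ (l : MvPolynomial (Fin 2) K) ∣ f,
        (1 : ℤ) =
      (Fintype.card K - 1) * (1 + quadraticChar K (quadDisc f)) := by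
  obtain ⟨a, rfl⟩ := exists_eq_binForm f
  rw [quadDisc_binForm, ← card_isotropic hK]
  · rw [Finset.sum_const, nsmul_eq_mul, mul_one]
    congr 1
    symm
    refine Finset.card_equiv (linearFormEquiv K) fun z => ?_
    simp only [Finset.mem_filter, Finset.mem_univ, true_and, linearFormEquiv_apply]
    have hz : z = 0 ↔ ![z.1, z.2] = 0 := by
      simp [Prod.ext_iff, _root_.funext_iff, Fin.forall_fin_succ]
    have hz' : (binForm ![z.1, z.2] : BinForm K 1) ≠ 0 ↔ z ≠ 0 :=
      not_iff_not.2 (binForm_eq_zero.trans hz.symm)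
    rw [hz']
    refine and_congr_right fun h => ?_
    rw [linear_dvd_quadratic_iff (fun h0 => h (hz.2 h0))]
    simp
  · rintro ⟨h0, h1, h2⟩
    apply hf
    rw [binForm_eq_zero]
    ext i
    fin_cases i <;> assumption

lemma sum_quadraticChar_quadDisc [Fintype K] [DecidableEq K] (hK : ringChar K ≠ 2) :
    ∑ f : BinForm K 2, quadraticChar K (quadDisc f) =
      Fintype.card K * (Fintype.card K - 1 : ℤ) := by
  rw [← sum_quadraticChar_disc hK, ← (quadraticFormEquiv K).sum_comp]
  refine Finset.sum_congr rfl fun z _ => ?_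
  rw [quadraticFormEquiv_apply, quadDisc_binForm]
  rfl

lemma squarefree_of_degree_one {n : ℕ} (hn : n ≤ 1) {h : BinForm K n} (hh : h ≠ 0) :
    Squarefree (h : MvPolynomial (Fin 2) K) := by
  interval_cases n
  · exact (isUnit_coe_of_degree_zero hh).squarefree
  · exact (irreducible_coe_of_degree_one hh).squarefree

/-- A repeated factor g is homogeneous and 2 deg g ≤ 5, so its degree is 1 or 2. -/
lemma exists_sq_dvd_of_isSingularForm {v : BinForm K 5} (hv : v ≠ 0) (h : IsSingularForm v) :
    (∃ l : BinForm K 1, l ≠ 0 ∧ (l * l : MvPolynomial (Fin 2) K) ∣ v) ∨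
      ∃ f : BinForm K 2, f ≠ 0 ∧ (f * f : MvPolynomial (Fin 2) K) ∣ v := by
  have hv' := coe_ne_zero_of_ne_zero hv
  simp only [IsSingularForm, Squarefree, not_forall] at h
  obtain ⟨g, hg, hu⟩ := h
  have hhom := IsHomogeneous.of_dvd v.2 hv' ((dvd_mul_left g g).trans hg)
  have hg0 : g ≠ 0 := by
    rintro rfl
    exact hv' (zero_dvd_iff.1 (by simpa using hg))
  have hle : g.totalDegree + g.totalDegree ≤ 5 := by
    obtain ⟨q, hq⟩ := hg
    have hq0 : q ≠ 0 := by
      rintro rfl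
      exact hv' (by rw [hq, mul_zero])
    have := IsHomogeneous.totalDegree v.2 hv'
    rw [hq, totalDegree_mul_of_isDomain (mul_ne_zero hg0 hg0) hq0,
      totalDegree_mul_of_isDomain hg0 hg0] at this
    omega
  have hcases : g.totalDegree = 0 ∨ g.totalDegree = 1 ∨ g.totalDegree = 2 := by omega
  rcases hcases with h0 | h1 | h2
  · rw [h0] at hhom
    exact absurd (isUnit_coe_of_degree_zero (v := ⟨g, hhom⟩) fun h => hg0 (congrArg Subtype.val h)) hu
  · rw [h1] at hhom
    exact Or.inl ⟨⟨g, hhom⟩, fun h => hg0 (congrArg Subtype.val h), hg⟩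
  · rw [h2] at hhom
    exact Or.inr ⟨⟨g, hhom⟩, fun h => hg0 (congrArg Subtype.val h), hg⟩

lemma isSingularForm_of_sq_dvd {n m : ℕ} (hm : m ≠ 0) {v : BinForm K n} (g : BinForm K m)
    (h : (g * g : MvPolynomial (Fin 2) K) ∣ v) : IsSingularForm v :=
  fun hs => not_isUnit_coe hm (hs _ h)

lemma isSingularForm_zero (n : ℕ) : IsSingularForm (0 : BinForm K n) := not_squarefree_zero

open Classical in
/-- The inclusion-exclusion formula for the indicator function of singular quintic forms. -/
lemma singular_indicator [Fintype K] [DecidableEq K] (hK : ringChar K ≠ 2) (v : BinForm K 5) :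
    (Fintype.card K - 1 : ℤ) * (if IsSingularForm v then 1 else 0) =
      ∑ _l ∈ Finset.univ.filter fun l : BinForm K 1 =>
          l ≠ 0 ∧ (l * l : MvPolynomial (Fin 2) K) ∣ v, (1 : ℤ) -
      ∑ f ∈ Finset.univ.filter fun f : BinForm K 2 =>
          f ≠ 0 ∧ (f * f : MvPolynomial (Fin 2) K) ∣ v, quadraticChar K (quadDisc f) := by
  -- For v = 0 every form counts, and the identity reads (q² - 1) - q(q - 1) = q - 1.
  by_cases hv : v = 0
  · subst hv
    have hnz (n : ℕ) : (Finset.univ.filter fun l : BinForm K n => l ≠ 0 ∧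
        (l * l : MvPolynomial (Fin 2) K) ∣ (0 : BinForm K 5)) = Finset.univ.erase 0 := by
      ext
      simp
    have hdisc : ∑ f ∈ Finset.univ.erase 0, quadraticChar K (quadDisc f : K) =
        Fintype.card K * (Fintype.card K - 1 : ℤ) := by
      rw [← sum_quadraticChar_quadDisc hK, Finset.sum_erase]
      simp [quadDisc]
    rw [if_pos (isSingularForm_zero 5), hnz, hnz, hdisc, Finset.sum_const,
      Finset.card_erase_of_mem (Finset.mem_univ _), Finset.card_univ, card_binForm, nsmul_eq_mul,
      Nat.cast_sub (Nat.one_le_pow _ _ Fintype.card_pos)]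
    push_cast
    ring
  have hv' := coe_ne_zero_of_ne_zero hv
  have hdisc (f : BinForm K 2) (c : Kˣ) : quadraticChar K (quadDisc (c • f)) =
      quadraticChar K (quadDisc f) := by
    rw [Units.smul_def, quadDisc_smul, map_mul, quadraticChar_sq_one' c.ne_zero, one_mul]
  by_cases hA : ∃ f : BinForm K 2, f ≠ 0 ∧ (f * f : MvPolynomial (Fin 2) K) ∣ v
  · obtain ⟨f, hf, hfv⟩ := hA
    have hf' := coe_ne_zero_of_ne_zero hf
    have hff : mulForm (rfl : 2 + 2 = 4) f f ≠ 0 := fun h =>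
      mul_ne_zero hf' hf' (congrArg Subtype.val h)
    obtain ⟨h, hh⟩ := (coe_dvd_coe_iff (rfl : 4 + 1 = 5) hff).1 hfv
    have hh0 : h ≠ 0 := by
      rintro rfl
      exact hv (by rw [← hh]; exact Subtype.ext (by simp))
    -- Since v = f²h with h linear, hence squarefree, the square divisors of v come exactly from the
    -- divisors of f.
    have hiff (n : ℕ) (g : BinForm K n) : (g * g : MvPolynomial (Fin 2) K) ∣ v ↔
        (g : MvPolynomial (Fin 2) K) ∣ f := by
      have hveq : (v : MvPolynomial (Fin 2) K) = f * f * h := by rw [← hh]; rfl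
      constructor
      · intro hg
        rw [hveq] at hg
        exact dvd_of_sq_dvd_sq_mul hf' (squarefree_of_degree_one le_rfl hh0) hg
      · intro hg
        exact (mul_dvd_mul hg hg).trans hfv
    rw [Finset.filter_congr fun (g : BinForm K 1) _ => and_congr_right fun _ => hiff 1 g,
      Finset.filter_congr fun (g : BinForm K 2) _ => and_congr_right fun _ => hiff 2 g]
    rw [if_pos (isSingularForm_of_sq_dvd two_ne_zero f hfv), card_linear_divisors hK hf,
      sum_divisors_of_same_degree hf (fun g => quadraticChar K (quadDisc g)) (hdisc f)]
    ring
  · have hempty : (Finset.univ.filter fun f : BinForm K 2 =>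
        f ≠ 0 ∧ (f * f : MvPolynomial (Fin 2) K) ∣ v) = ∅ :=
      Finset.filter_eq_empty_iff.2 fun f _ h => hA ⟨f, h⟩
    rw [hempty, Finset.sum_empty, sub_zero]
    by_cases hB : ∃ l : BinForm K 1, l ≠ 0 ∧ (l * l : MvPolynomial (Fin 2) K) ∣ v
    · obtain ⟨l, hl, hlv⟩ := hB
      have hl' := coe_ne_zero_of_ne_zero hl
      have hiff (g : BinForm K 1) : g ≠ 0 ∧ (g * g : MvPolynomial (Fin 2) K) ∣ v ↔
          g ≠ 0 ∧ (g : MvPolynomial (Fin 2) K) ∣ l := by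
        refine and_congr_right fun hg => ⟨fun hgv => ?_, fun h => (mul_dvd_mul h h).trans hlv⟩
        -- If g were not proportional to l, then (gl)² would divide v, against the absence of
        -- quadratic f with f² ∣ v.
        by_contra hgl
        have hg' := coe_ne_zero_of_ne_zero hg
        have hrel : IsRelPrime (g : MvPolynomial (Fin 2) K) l :=
          (irreducible_coe_of_degree_one hg).isRelPrime_iff_not_dvd.2 hgl
        refine hA ⟨mulForm (rfl : 1 + 1 = 2) g l, fun h => ?_, ?_⟩
        · exact mul_ne_zero hg' hl' (congrArg Subtype.val h)
        · rw [coe_mulForm, mul_mul_mul_comm]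
          exact ((hrel.mul_left hrel).mul_right (hrel.mul_left hrel)).mul_dvd hgv hlv
      rw [Finset.filter_congr fun g _ => hiff g,
        if_pos (isSingularForm_of_sq_dvd one_ne_zero l hlv),
        sum_divisors_of_same_degree hl (fun _ => 1) fun _ => rfl]
    · rw [if_neg, Finset.filter_eq_empty_iff.2 fun f _ h => hB ⟨f, h⟩]
      · simp
      · intro h
        exact (exists_sq_dvd_of_isSingularForm hv h).elim hB hA

end SquareDivisors

/-! ### The exponential sum -/

section ProjectiveSum

open Classical in
-- Each point of the projective space is represented by q - 1 nonzero vectors.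
lemma sum_ne_zero_eq_sum_projectivization {K V : Type*} [Field K] [Fintype K] [AddCommGroup V]
    [Module K V] [Fintype V] [Fintype (Projectivization K V)] (G : V → ℤ)
    (hG : ∀ c : K, c ≠ 0 → ∀ v : V, G (c • v) = G v) [DecidablePred fun v : V => v ≠ 0] :
    ∑ v ∈ Finset.univ.filter fun v : V => v ≠ 0, G v =
      (Fintype.card K - 1) * ∑ P : Projectivization K V, G P.rep := by
  rw [Finset.mul_sum, ← Finset.sum_subtype_eq_sum_filter]
  have key := Finset.sum_fiberwise (Finset.univ : Finset {v : V // v ≠ 0})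
    (fun v => Projectivization.mk K v.1 v.2) (fun v => G v.1)
  rw [Finset.sum_congr (Finset.subtype_univ _) fun _ _ => rfl, ← key]
  refine Finset.sum_congr rfl fun P _ => ?_
  have : (Finset.univ.filter fun v : {v : V // v ≠ 0} => Projectivization.mk K v.1 v.2 = P) =
      Finset.univ.image fun c : Kˣ => ⟨c • P.rep, (smul_ne_zero_iff_ne c).2 P.rep_nonzero⟩ := by
    ext v
    simp only [Finset.mem_filter, Finset.mem_univ, true_and, Finset.mem_image]
    conv_lhs => rw [← P.mk_rep, Projectivization.mk_eq_mk_iff]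
    exact exists_congr fun c => (Subtype.ext_iff (a1 := ⟨c • P.rep, _⟩) (a2 := v)).symm
  rw [this, Finset.sum_image]
  · simp only [Units.smul_def, hG _ (Units.ne_zero _), Finset.sum_const, Finset.card_univ,
      Fintype.card_units, nsmul_eq_mul]
    rw [Nat.cast_sub Fintype.card_pos, Nat.cast_one]
  · intro c _ c' _ h
    apply Units.ext
    exact smul_left_injective K P.rep_nonzero (congrArg Subtype.val h)

open Classical in
/-- The right hand side does not depend on the choice of the representatives. -/
lemma sum_apolar_squares {K : Type*} [Field K] [Fintype K] [DecidableEq K] (w : DualBinForm K 5)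
    [Fintype (Projectivization K (BinForm K 2))] :
    ∑ f ∈ Finset.univ.filter fun f : BinForm K 2 =>
        f ≠ 0 ∧ IsApolar w (mulForm (rfl : 2 + 2 = 4) f f), quadraticChar K (quadDisc f) =
      (Fintype.card K - 1) * ∑ P ∈ Finset.univ.filter fun P : Projectivization K (BinForm K 2) =>
        IsApolar w (mulForm (rfl : 2 + 2 = 4) P.rep P.rep), quadraticChar K (quadDisc P.rep) := by
  have key := sum_ne_zero_eq_sum_projectivization (K := K) (fun f : BinForm K 2 =>
    if IsApolar w (mulForm (rfl : 2 + 2 = 4) f f) then quadraticChar K (quadDisc f) else 0) ?_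
  · rw [← Finset.sum_filter, ← Finset.sum_filter, Finset.filter_filter] at key
    exact key
  · intro c hc f
    have hiff : IsApolar w (mulForm (rfl : 2 + 2 = 4) (c • f) (c • f)) ↔
        IsApolar w (mulForm (rfl : 2 + 2 = 4) f f) := by
      rw [smul_mulForm, mulForm_smul]
      refine ⟨fun h => ?_, fun h => (h.smul _).smul _⟩
      have h' := h.smul (c⁻¹ * c⁻¹)
      rw [smul_smul, smul_smul, show c⁻¹ * c⁻¹ * c * c = 1 by field_simp, one_smul] at h'
      exact h'
    simp only [hiff, quadDisc_smul, map_mul, quadraticChar_sq_one' hc, one_mul]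

end ProjectiveSum

section ExponentialSum

variable {p : ℕ} [Fact p.Prime]

open Classical in
lemma card_sub_one_mul_quinticC (w : DualBinForm (ZMod p) 5) :
    (p - 1 : ℤ) * quinticC w = -∑ f ∈ Finset.univ.filter fun f : BinForm (ZMod p) 2 =>
      f ≠ 0 ∧ IsApolar w (mulForm (rfl : 2 + 2 = 4) f f), quadraticChar (ZMod p) (quadDisc f) := by
  have : Fintype (Projectivization (ZMod p) (BinForm (ZMod p) 2)) := Fintype.ofFinite _
  have key := sum_apolar_squares w
  rw [ZMod.card] at key
  rw [key, quinticC, finsum_mem_eq_finite_toFinset_sum _ (Set.toFinite _), mul_neg]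
  refine congrArg Neg.neg (congrArg _ (Finset.sum_congr ?_ fun _ _ => rfl))
  ext
  simp

/-- Orthogonality of characters. -/
lemma sum_stdAddChar_linear {V : Type*} [AddCommGroup V] [Module (ZMod p) V] [Fintype V]
    (L : V →ₗ[ZMod p] ZMod p) [Decidable (L = 0)] :
    ∑ u, ZMod.stdAddChar (L u) = if L = 0 then (Fintype.card V : ℂ) else 0 := by
  classical
  have h := AddChar.sum_eq_ite ((ZMod.stdAddChar (N := p)).compAddMonoidHom L.toAddMonoidHom)
  simp only [AddChar.compAddMonoidHom_apply, LinearMap.toAddMonoidHom_coe] at h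
  rw [h]
  congr 1
  rw [eq_iff_iff]
  constructor
  · intro h0
    ext u
    have := DFunLike.congr_fun h0 u
    apply ZMod.injective_stdAddChar
    simpa using this
  · rintro rfl
    ext u
    simp

open Classical in
-- The multiples of f² are f²u with u ∈ V_d^*, uniquely. The functional u ↦ (w, f²u) vanishes
-- exactly when f² ∈ w^⊥, so orthogonality of characters applies.
lemma sum_sq_dvd {m e d : ℕ} (he : m + m = e) (hd : e + d = 5) (w : DualBinForm (ZMod p) 5)
    {f : BinForm (ZMod p) m} (hf : f ≠ 0) :
    ∑ v ∈ Finset.univ.filter fun v : BinForm (ZMod p) 5 =>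
        (f * f : MvPolynomial (Fin 2) (ZMod p)) ∣ v, ZMod.stdAddChar (w v) =
      if IsApolar w (mulForm he f f) then (p : ℂ) ^ (d + 1) else 0 := by
  have hf' := coe_ne_zero_of_ne_zero hf
  have hff : mulForm he f f ≠ 0 := fun h => mul_ne_zero hf' hf' (congrArg Subtype.val h)
  have himage : (Finset.univ.filter fun v : BinForm (ZMod p) 5 =>
      (f * f : MvPolynomial (Fin 2) (ZMod p)) ∣ v) =
      Finset.univ.image fun u : BinForm (ZMod p) d => mulForm hd (mulForm he f f) u := by
    ext v
    simp only [Finset.mem_filter, Finset.mem_univ, true_and, Finset.mem_image]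
    exact coe_dvd_coe_iff hd hff
  let L : BinForm (ZMod p) d →ₗ[ZMod p] ZMod p :=
    { toFun := fun u => w (mulForm hd (mulForm he f f) u)
      map_add' := fun u u' => by
        rw [← map_add]
        congr 1
        exact Subtype.ext (mul_add _ _ _)
      map_smul' := fun c u => by rw [mulForm_smul, map_smul, RingHom.id_apply] }
  have hL : L = 0 ↔ IsApolar w (mulForm he f f) := by
    constructor
    · intro h0 d' h' u
      obtain rfl : d = d' := by omega
      exact DFunLike.congr_fun h0 u
    · intro h
      ext u
      exact h d hd u
  rw [himage, Finset.sum_image]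
  · have := sum_stdAddChar_linear L
    simp only [hL, card_binForm, ZMod.card, Nat.cast_pow] at this
    exact this
  · intro u _ u' _ h
    exact Subtype.ext (mul_left_cancel₀ (coe_ne_zero_of_ne_zero hff) (congrArg Subtype.val h))

open Classical in
lemma expSum_eq_sum (w : DualBinForm (ZMod p) 5) :
    (p : ℂ) ^ 6 * expSum w =
      ∑ v, (if IsSingularForm v then 1 else 0 : ℤ) * ZMod.stdAddChar (w v) := by
  have hp : (p : ℂ) ≠ 0 := Nat.cast_ne_zero.2 (Fact.out : p.Prime).ne_zero
  rw [expSum, Nat.card_eq_fintype_card, card_binForm, ZMod.card, ← mul_assoc,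
    finsum_mem_eq_finite_toFinset_sum _ (Set.toFinite _)]
  have : (p : ℂ) ^ 6 * (1 / ((p ^ (5 + 1) : ℕ) : ℂ)) = 1 := by
    push_cast
    field_simp
  rw [this, one_mul]
  simp only [Int.cast_ite, Int.cast_one, Int.cast_zero, ite_mul, one_mul, zero_mul]
  rw [← Finset.sum_filter]
  refine Finset.sum_congr (by ext; simp) fun v _ => ?_
  have := ZMod.stdAddChar_coe (N := p) (w v).val
  rw [Int.cast_natCast, ZMod.natCast_zmod_val] at this
  rw [this]
  push_cast
  rfl

/-- The exponential sum of singular quintic forms is governed by `quinticC` at functionals that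
are apolar to no nonzero quadratic form. -/
theorem expSum_eq_quinticC (hp : 2 < p) (w : DualBinForm (ZMod p) 5)
    (hw : ∀ f : BinForm (ZMod p) 2, IsApolar w f → f = 0) :
    expSum w = (quinticC w : ℂ) / (p : ℂ) ^ 4 := by
  classical
  have hp0 : (p : ℂ) ≠ 0 := Nat.cast_ne_zero.2 (Fact.out : p.Prime).ne_zero
  have hp1 : (p - 1 : ℂ) ≠ 0 := by
    rw [sub_ne_zero]
    exact_mod_cast (Fact.out : p.Prime).one_lt.ne'
  have hK : ringChar (ZMod p) ≠ 2 := by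
    rw [ZMod.ringChar_zmod_n]
    omega
  have swap (n : ℕ) (G : BinForm (ZMod p) n → ℤ) :
      ∑ v : BinForm (ZMod p) 5, ((∑ f ∈ Finset.univ.filter fun f : BinForm (ZMod p) n =>
        f ≠ 0 ∧ (f * f : MvPolynomial (Fin 2) (ZMod p)) ∣ v, G f : ℤ) : ℂ) *
          ZMod.stdAddChar (w v) =
      ∑ f ∈ Finset.univ.filter fun f : BinForm (ZMod p) n => f ≠ 0, (G f : ℂ) *
        ∑ v ∈ Finset.univ.filter fun v : BinForm (ZMod p) 5 =>
          (f * f : MvPolynomial (Fin 2) (ZMod p)) ∣ v, ZMod.stdAddChar (w v) := by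
    simp only [Finset.mul_sum, Int.cast_sum, Finset.sum_mul, Finset.sum_filter, ite_and]
    rw [Finset.sum_comm]
    refine Finset.sum_congr rfl fun f _ => ?_
    split_ifs
    · exact Finset.sum_congr rfl fun v _ => by split_ifs <;> simp
    · simp
  -- Here l² is a nonzero quadratic form, so by `hw` it is never apolar to w.
  have hlin : ∑ l ∈ Finset.univ.filter fun l : BinForm (ZMod p) 1 => l ≠ 0, ((1 : ℤ) : ℂ) *
        ∑ v ∈ Finset.univ.filter fun v : BinForm (ZMod p) 5 =>
          (l * l : MvPolynomial (Fin 2) (ZMod p)) ∣ v, ZMod.stdAddChar (w v) = 0 := by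
    refine Finset.sum_eq_zero fun l hl => ?_
    have hl0 := (Finset.mem_filter.1 hl).2
    have hl' := coe_ne_zero_of_ne_zero hl0
    rw [sum_sq_dvd (rfl : 1 + 1 = 2) (rfl : 2 + 3 = 5) w hl0, if_neg, mul_zero]
    exact fun h => mul_ne_zero hl' hl' (congrArg Subtype.val (hw _ h))
  -- The cofactor of f² is linear, so each f with f² ∈ w^⊥ has weight p², and the sum over f ≠ 0 is
  -- p - 1 times the projective sum.
  have hquad : ∑ f ∈ Finset.univ.filter fun f : BinForm (ZMod p) 2 => f ≠ 0,
      (quadraticChar (ZMod p) (quadDisc f) : ℂ) *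
        ∑ v ∈ Finset.univ.filter fun v : BinForm (ZMod p) 5 =>
          (f * f : MvPolynomial (Fin 2) (ZMod p)) ∣ v, ZMod.stdAddChar (w v) =
      -((p : ℂ) ^ 2 * ((p - 1) * quinticC w)) := by
    have hC : ((p - 1) * quinticC w : ℂ) = ((p - 1 : ℤ) * quinticC w : ℤ) := by push_cast; rfl
    rw [hC, card_sub_one_mul_quinticC, ← Finset.filter_filter, Finset.sum_filter (p := fun f =>
      IsApolar w (mulForm _ f f))]
    push_cast
    rw [mul_neg, neg_neg, Finset.mul_sum]
    refine Finset.sum_congr rfl fun f hf => ?_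
    rw [sum_sq_dvd (rfl : 2 + 2 = 4) (rfl : 4 + 1 = 5) w (Finset.mem_filter.1 hf).2]
    split_ifs
    · ring
    · simp
  have main : (p - 1 : ℂ) * ((p : ℂ) ^ 6 * expSum w) = (p : ℂ) ^ 2 * ((p - 1) * quinticC w) := by
    rw [expSum_eq_sum, Finset.mul_sum]
    have (v : BinForm (ZMod p) 5) : (p - 1 : ℂ) * ((if IsSingularForm v then 1 else 0 : ℤ) *
        ZMod.stdAddChar (w v)) =
        ((((p - 1 : ℤ) * (if IsSingularForm v then 1 else 0) : ℤ)) : ℂ) *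
          ZMod.stdAddChar (w v) := by
      push_cast
      ring
    have hind := singular_indicator hK
    rw [ZMod.card] at hind
    simp only [this, hind, Int.cast_sub, sub_mul, Finset.sum_sub_distrib]
    rw [swap 1 fun _ => 1, swap 2 fun f => quadraticChar (ZMod p) (quadDisc f), hlin, hquad]
    ring
  rw [eq_div_iff (pow_ne_zero 4 hp0)]
  apply mul_left_cancel₀ (mul_ne_zero hp1 (pow_ne_zero 2 hp0))
  linear_combination main

end ExponentialSum

/-! ### Waring types -/

section WaringType

variable {K : Type*} [Field K]

lemma monomial_monoExp {k : Type*} [CommSemiring k] (n i : ℕ) (a : k) :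
    monomial (monoExp n i) a = C a * (X 0 ^ (n - i) * X 1 ^ i) := by
  simp [monoExp, X_pow_eq_monomial, monomial_mul, C_mul_monomial]

lemma coe_linear (a b : K) : (binForm ![a, b] : MvPolynomial (Fin 2) K) = C a * X 0 + C b * X 1 := by
  rw [coe_binForm]
  simp [monomial_monoExp]

lemma coe_cubic (a b c d : K) : (binForm ![a, b, c, d] : MvPolynomial (Fin 2) K) =
    C a * X 0 ^ 3 + C b * (X 0 ^ 2 * X 1) + C c * (X 0 * X 1 ^ 2) + C d * X 1 ^ 3 := by
  rw [coe_binForm]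
  simp [monomial_monoExp, Fin.sum_univ_four]

lemma not_associated_linear {l m : Fin 2 → K} (h : l 0 * m 1 ≠ l 1 * m 0) :
    ¬ Associated (binForm l : MvPolynomial (Fin 2) K) (binForm m : BinForm K 1) := by
  intro ha
  have hm : (binForm m : BinForm K 1) ≠ 0 := by
    rw [Ne, binForm_eq_zero]
    rintro rfl
    simp at h
  obtain ⟨c, hc⟩ := exists_smul_of_dvd hm ha.dvd
  rw [Units.smul_def, smul_binForm, binForm_inj] at hc
  apply h
  simp only [hc, Pi.smul_apply, smul_eq_mul]
  ring

lemma hasSplittingType_of_linear {n r : ℕ} {φ : BinForm K n} (l : Fin r → Fin 2 → K) (e : Fin r → ℕ)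
    (hl0 : ∀ i, l i ≠ 0) (hl : ∀ i j, i ≠ j → l i 0 * l j 1 ≠ l i 1 * l j 0) (he : ∀ i, 0 < e i)
    (hφ : (φ : MvPolynomial (Fin 2) K) = ∏ i, (binForm (l i) : MvPolynomial (Fin 2) K) ^ e i) :
    HasSplittingType φ (Finset.univ.val.map fun i => (1, e i)) := by
  have h0 (i : Fin r) : (binForm (l i) : BinForm K 1) ≠ 0 := fun h => hl0 i (binForm_eq_zero.1 h)
  refine ⟨r, fun i => binForm (l i), e, fun i => irreducible_coe_of_degree_one (h0 i),
    fun i j hij => not_associated_linear (hl i j hij), he, by rw [hφ], ?_⟩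
  refine Multiset.map_congr rfl fun i _ => ?_
  rw [IsHomogeneous.totalDegree (binForm (l i)).2 (coe_ne_zero_of_ne_zero (h0 i))]

/-- By associativity of multiplication, w^⊥ is an ideal. -/
lemma IsApolar.mulForm {m d e n : ℕ} {w : DualBinForm K n} {v : BinForm K m} (hv : IsApolar w v)
    (h : m + d = e) (u : BinForm K d) : IsApolar w (mulForm h v u) := by
  intro d' h' z
  rw [← hv (d + d') (by omega) (_root_.mulForm rfl u z)]
  congr 1
  exact Subtype.ext (mul_assoc _ _ _)

/-- An apolar form of degree r < 3, multiplied by x^(2 - r), becomes an apolar quadratic form, so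
excluding degree 2 excludes all smaller degrees. -/
lemma hasWaringType_of_cubic {n : ℕ} {w : DualBinForm K n} {T : Multiset (ℕ × ℕ)}
    (hw : ∀ f : BinForm K 2, IsApolar w f → f = 0) {φ : BinForm K 3} (hφ : IsApolar w φ)
    (hφ0 : φ ≠ 0) (hT : HasSplittingType φ T) : HasWaringType w T := by
  refine ⟨3, φ, ⟨hφ0, hφ, fun r hr ψ hψ => ?_⟩, hT⟩
  let u : BinForm K (2 - r) := binForm (Pi.single 0 1)
  have hu : u ≠ 0 := by
    rw [Ne, binForm_eq_zero]
    simp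
  have h0 := hw _ (hψ.mulForm (show r + (2 - r) = 2 by omega) u)
  have h1 := congrArg Subtype.val h0
  exact Subtype.ext ((mul_eq_zero.1 h1).resolve_right (coe_ne_zero_of_ne_zero hu))

/-- Reduces C(w) to a complete list of pairwise non-proportional solutions of f² ∈ w^⊥; the choice
of representatives changes Disc f only by a nonzero square. -/
lemma sum_apolar_squares_eq [Fintype K] [DecidableEq K] {ι : Type*} [Fintype ι]
    (w : DualBinForm K 5) (v : ι → Fin 3 → K) (hv : ∀ i, v i ≠ 0)
    (hinj : ∀ i j (c : K), v i = c • v j → i = j)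
    (hapolar : ∀ i, IsApolar w (mulForm (rfl : 2 + 2 = 4) (binForm (v i)) (binForm (v i))))
    (hsol : ∀ f : Fin 3 → K, IsApolar w (mulForm (rfl : 2 + 2 = 4) (binForm f) (binForm f)) →
      ∃ i, ∃ c : K, f = c • v i) :
    ∑ᶠ f ∈ {f : Projectivization K (BinForm K 2) |
        IsApolar w (mulForm (rfl : 2 + 2 = 4) f.rep f.rep)}, quadraticChar K (quadDisc f.rep) =
      ∑ i, quadraticChar K (v i 1 ^ 2 - 4 * v i 0 * v i 2) := by
  have hv' (i : ι) : (binForm (v i) : BinForm K 2) ≠ 0 := fun h => hv i (binForm_eq_zero.1 h)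
  let P (i : ι) : Projectivization K (BinForm K 2) := Projectivization.mk K _ (hv' i)
  have hrep (i : ι) : ∃ c : K, c ≠ 0 ∧ c • binForm (v i) = (P i).rep := by
    obtain ⟨c, hc⟩ := Projectivization.exists_smul_eq_mk_rep K _ (hv' i)
    exact ⟨c, c.ne_zero, hc⟩
  have hP : Function.Injective P := by
    intro i j hij
    obtain ⟨c, hc⟩ := (Projectivization.mk_eq_mk_iff' K _ _ (hv' i) (hv' j)).1 hij
    rw [smul_binForm, binForm_inj] at hc
    exact hinj i j c hc.symm
  have hset : {f : Projectivization K (BinForm K 2) |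
      IsApolar w (mulForm (rfl : 2 + 2 = 4) f.rep f.rep)} = Set.range P := by
    ext f
    simp only [Set.mem_ofPred_eq, Set.mem_range]
    constructor
    · intro hf
      obtain ⟨a, ha⟩ := exists_eq_binForm f.rep
      rw [ha] at hf
      obtain ⟨i, c, hc⟩ := hsol a hf
      have hc0 : c ≠ 0 := by
        rintro rfl
        exact f.rep_nonzero (by rw [ha, hc, zero_smul, binForm_zero])
      refine ⟨i, ?_⟩
      rw [← f.mk_rep, Projectivization.mk_eq_mk_iff' K _ _ (hv' i) f.rep_nonzero]
      exact ⟨c⁻¹, by rw [ha, hc, smul_binForm, smul_smul, inv_mul_cancel₀ hc0, one_smul]⟩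
    · rintro ⟨i, rfl⟩
      obtain ⟨c, -, hc⟩ := hrep i
      rw [← hc, smul_mulForm, mulForm_smul]
      exact ((hapolar i).smul _).smul _
  rw [hset, finsum_mem_range hP, finsum_eq_sum_of_fintype]
  refine Finset.sum_congr rfl fun i _ => ?_
  obtain ⟨c, hc0, hc⟩ := hrep i
  rw [← hc, quadDisc_smul, map_mul, quadraticChar_sq_one' hc0, one_mul, quadDisc_binForm]

lemma isApolar_quadratic_iff (a : Fin 6 → K) (f : Fin 3 → K) :
    IsApolar (dualForm a) (binForm f : BinForm K 2) ↔
      f 0 * a 0 + f 1 * a 1 + f 2 * a 2 = 0 ∧ f 0 * a 1 + f 1 * a 2 + f 2 * a 3 = 0 ∧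
      f 0 * a 2 + f 1 * a 3 + f 2 * a 4 = 0 ∧ f 0 * a 3 + f 1 * a 4 + f 2 * a 5 = 0 := by
  rw [isApolar_dualForm_iff (rfl : 2 + 3 = 5)]
  simp [Fin.forall_fin_succ, Fin.sum_univ_three]

lemma isApolar_cubic_iff (a : Fin 6 → K) (f : Fin 4 → K) :
    IsApolar (dualForm a) (binForm f : BinForm K 3) ↔
      f 0 * a 0 + f 1 * a 1 + f 2 * a 2 + f 3 * a 3 = 0 ∧
      f 0 * a 1 + f 1 * a 2 + f 2 * a 3 + f 3 * a 4 = 0 ∧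
      f 0 * a 2 + f 1 * a 3 + f 2 * a 4 + f 3 * a 5 = 0 := by
  rw [isApolar_dualForm_iff (rfl : 3 + 2 = 5)]
  simp [Fin.forall_fin_succ, Fin.sum_univ_four]

lemma isApolar_sq_iff (a : Fin 6 → K) (f : Fin 3 → K) :
    IsApolar (dualForm a) (mulForm (rfl : 2 + 2 = 4) (binForm f) (binForm f)) ↔
      f 0 * f 0 * a 0 + 2 * (f 0 * f 1) * a 1 + (2 * (f 0 * f 2) + f 1 * f 1) * a 2 +
        2 * (f 1 * f 2) * a 3 + f 2 * f 2 * a 4 = 0 ∧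
      f 0 * f 0 * a 1 + 2 * (f 0 * f 1) * a 2 + (2 * (f 0 * f 2) + f 1 * f 1) * a 3 +
        2 * (f 1 * f 2) * a 4 + f 2 * f 2 * a 5 = 0 := by
  have hf : f = ![f 0, f 1, f 2] := by ext i; fin_cases i <;> rfl
  rw [hf, mulForm_quadratic_self, isApolar_dualForm_iff (rfl : 4 + 1 = 5)]
  simp [Fin.forall_fin_succ, Fin.sum_univ_five]

end WaringType

/-! ### The three families -/

section Families

variable {p : ℕ} [Fact p.Prime]

lemma realizes_of_cubic (hp : 2 < p) {w : DualBinForm (ZMod p) 5} {T : Multiset (ℕ × ℕ)} {c : ℤ}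
    (hw : ∀ f : BinForm (ZMod p) 2, IsApolar w f → f = 0) {φ : BinForm (ZMod p) 3}
    (hφ : IsApolar w φ) (hφ0 : φ ≠ 0) (hT : HasSplittingType φ T) (hc : quinticC w = c) :
    Realizes p w T c :=
  ⟨‹_›, hp, hasWaringType_of_cubic hw hφ hφ0 hT, hc, expSum_eq_quinticC hp w hw⟩

lemma ne_zero_of_two_lt (hp : 2 < p) : (2 : ZMod p) ≠ 0 := by
  apply Ring.two_ne_zero
  rw [ZMod.ringChar_zmod_n]
  omega

lemma four_ne_zero_of_two_lt (hp : 2 < p) : (4 : ZMod p) ≠ 0 := by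
  have h : (4 : ZMod p) = 2 * 2 := by norm_num
  rw [h]
  exact mul_ne_zero (ne_zero_of_two_lt hp) (ne_zero_of_two_lt hp)

lemma quadraticChar_intCast (a : ℤ) : quadraticChar (ZMod p) (a : ZMod p) = jacobiSym a p := by
  rw [← jacobiSym.legendreSym.to_jacobiSym, legendreSym]

lemma binForm_eq_zero_of_forall {f : BinForm (ZMod p) 2}
    (h : ∀ a : Fin 3 → ZMod p, f = binForm a → a 0 = 0 ∧ a 1 = 0 ∧ a 2 = 0) : f = 0 := by
  obtain ⟨a, rfl⟩ := exists_eq_binForm f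
  obtain ⟨h0, h1, h2⟩ := h a rfl
  rw [binForm_eq_zero]
  ext i
  fin_cases i <;> assumption

/-- The conics are f₂(2f₁ + f₂) = 0 and 2f₀f₂ + f₁² + 2f₁f₂ + tf₂² = 0. They meet at x², of
discriminant 0, and at one point with f₂ ≠ 0, scaled to f₂ = 8 to clear denominators. -/
lemma realizes_cube (hp : 2 < p) (t : ℤ) :
    Realizes p (dualForm ![0, 0, 0, 1, 1, (t : ZMod p)]) typeCube (-jacobiSym (8 * t - 5) p) := by
  have h2 := ne_zero_of_two_lt hp
  have h4 := four_ne_zero_of_two_lt hp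
  have h8 : (8 : ZMod p) ≠ 0 := by
    have h : (8 : ZMod p) = 4 * 2 := by norm_num
    rw [h]
    exact mul_ne_zero h4 h2
  refine realizes_of_cubic hp (fun f hf => binForm_eq_zero_of_forall ?_)
    (φ := binForm ![1, 0, 0, 0]) ?_ ?_ ?_ ?_
  · rintro a rfl
    have := (isApolar_quadratic_iff _ _).1 hf
    simp at this
    obtain ⟨e0, e1, e2⟩ := this
    have h1 : a 1 = 0 := by simpa [e0] using e1
    exact ⟨by simpa [e0, h1] using e2, h1, e0⟩
  · rw [isApolar_cubic_iff]
    simp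
  · rw [Ne, binForm_eq_zero]
    intro h
    simpa using congrFun h 0
  · refine hasSplittingType_of_linear ![![1, 0]] ![3] ?_ ?_ ?_ ?_
    · intro i
      fin_cases i
      simp
    · intro i j hij
      exact absurd (Subsingleton.elim i j) hij
    · decide
    · simp [coe_linear, coe_cubic]
  · rw [quinticC, sum_apolar_squares_eq _
      (![![1, 0, 0], ![3 - 4 * t, -4, 8]] : Fin 2 → Fin 3 → ZMod p)]
    · have hD : (-4 : ZMod p) ^ 2 - 4 * (3 - 4 * t) * 8 = 4 ^ 2 * ((8 * t - 5 : ℤ) : ZMod p) := by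
        push_cast
        ring
      simp only [Fin.sum_univ_two]
      simp only [Matrix.cons_val, hD, map_mul, quadraticChar_sq_one' h4, one_mul,
        quadraticChar_intCast]
      simp
    · intro i
      fin_cases i <;> simp [h8]
    · intro i j c h
      have e0 := congrFun h 0
      have e2 := congrFun h 2
      fin_cases i <;> fin_cases j
      · rfl
      · simp [h8] at e0 e2
        simp [e2] at e0
      · simp [h8] at e2
      · rfl
    · intro i
      rw [isApolar_sq_iff]
      fin_cases i
      · simp
      · simp
        ring_nf
        simp
    · intro f hf
      obtain ⟨e0, e1⟩ := (isApolar_sq_iff _ _).1 hf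
      simp at e0 e1
      by_cases hf2 : f 2 = 0
      · have hf1 : f 1 = 0 := by simpa [hf2] using e1
        exact ⟨0, f 0, by ext i; fin_cases i <;> simp [hf1, hf2]⟩
      · have e0' : 2 * f 1 = -f 2 := by
          apply mul_left_cancel₀ hf2
          linear_combination e0
        refine ⟨1, f 2 / 8, ?_⟩
        ext i
        fin_cases i
        · simp
          field_simp
          apply mul_left_cancel₀ hf2
          linear_combination 4 * e1 - (2 * f 1 + 3 * f 2) * e0'
        · simp
          field_simp
          linear_combination 4 * e0'
        · simp
          field_simp

/-- The conics are f₀² = f₂² and f₂(2f₁ + tf₂) = 0. They meet at xy, whose discriminant 1 gives the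
constant term, and at two points f₀ = ±f₂, scaled to f₂ = 2. -/
lemma realizes_squareLine (hp : 2 < p) (t : ℤ) :
    Realizes p (dualForm ![-1, 0, 0, 0, 1, (t : ZMod p)]) typeSquareLine
      (-(1 + jacobiSym (t ^ 2 - 16) p + jacobiSym (t ^ 2 + 16) p)) := by
  have h2 := ne_zero_of_two_lt hp
  refine realizes_of_cubic hp (fun f hf => binForm_eq_zero_of_forall ?_)
    (φ := binForm ![0, 1, 0, 0]) ?_ ?_ ?_ ?_
  · rintro a rfl
    have := (isApolar_quadratic_iff _ _).1 hf
    simp at this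
    obtain ⟨e0, e2, e1⟩ := this
    exact ⟨e0, by simpa [e2] using e1, e2⟩
  · rw [isApolar_cubic_iff]
    simp
  · rw [Ne, binForm_eq_zero]
    intro h
    simpa using congrFun h 1
  · refine hasSplittingType_of_linear ![![1, 0], ![0, 1]] ![2, 1] ?_ ?_ ?_ ?_
    · intro i
      fin_cases i <;> simp
    · intro i j hij
      fin_cases i <;> fin_cases j <;> simp_all
    · decide
    · simp [coe_linear, coe_cubic]
  · rw [quinticC, sum_apolar_squares_eq _
      (![![0, 1, 0], ![2, -t, 2], ![-2, -t, 2]] : Fin 3 → Fin 3 → ZMod p)]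
    · have hD1 : (-t : ZMod p) ^ 2 - 4 * 2 * 2 = ((t ^ 2 - 16 : ℤ) : ZMod p) := by
        push_cast
        ring
      have hD2 : (-t : ZMod p) ^ 2 - 4 * (-2) * 2 = ((t ^ 2 + 16 : ℤ) : ZMod p) := by
        push_cast
        ring
      simp only [Fin.sum_univ_three]
      simp only [Matrix.cons_val, hD1, hD2, quadraticChar_intCast]
      simp
    · intro i
      fin_cases i <;> simp [h2]
    · intro i j c h
      have e0 := congrFun h 0
      have e2 := congrFun h 2
      have e1 := congrFun h 1
      have h4 := four_ne_zero_of_two_lt hp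
      fin_cases i <;> fin_cases j <;> simp at e0 e1 e2
      · rfl
      · simp [e2.resolve_right h2] at e1
      · simp [e2.resolve_right h2] at e1
      · exact absurd e0 h2
      · rfl
      · exact absurd (by linear_combination e0 + e2) h4
      · exact absurd e0 h2
      · exact absurd (by linear_combination e2 - e0) h4
      · rfl
    · intro i
      rw [isApolar_sq_iff]
      fin_cases i
      · simp
      · simp
        ring
      · simp
        ring
    · intro f hf
      obtain ⟨e0, e1⟩ := (isApolar_sq_iff _ _).1 hf
      simp at e0 e1
      by_cases hf2 : f 2 = 0
      · have hf0 : f 0 = 0 := by simpa [hf2] using e0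
        exact ⟨0, f 1, by ext i; fin_cases i <;> simp [hf0, hf2]⟩
      · have e1' : 2 * f 1 = -(f 2 * t) := by
          apply mul_left_cancel₀ hf2
          linear_combination e1
        have e0' : (f 0 - f 2) * (f 0 + f 2) = 0 := by linear_combination -e0
        rcases mul_eq_zero.1 e0' with h | h
        · refine ⟨1, f 2 / 2, ?_⟩
          ext i
          fin_cases i
          · simp
            field_simp
            linear_combination h
          · simp
            field_simp
            linear_combination e1'
          · simp
            field_simp
        · refine ⟨2, f 2 / 2, ?_⟩
          ext i
          fin_cases i
          · simp
            field_simp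
            linear_combination h
          · simp
            field_simp
            linear_combination e1'
          · simp
            field_simp

lemma threeLineQuintic_eq (α β γ : ZMod p) : threeLineQuintic p α β γ =
    dualForm ![α⁻¹ ^ 2 - γ⁻¹ ^ 2, -γ⁻¹ ^ 2, -γ⁻¹ ^ 2, -γ⁻¹ ^ 2, -γ⁻¹ ^ 2,
      β⁻¹ ^ 2 - γ⁻¹ ^ 2] := by
  simp only [threeLineQuintic, dualForm, Finset.smul_sum, ← Finset.sum_add_distrib,
    ← Finset.sum_sub_distrib, smul_smul, ← add_smul, ← sub_smul]
  refine Finset.sum_congr rfl fun i _ => ?_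
  congr 1
  fin_cases i <;> simp

/-- Here (w, v) = α⁻²v(1,0) + β⁻²v(0,1) - γ⁻²v(1,1), which is killed by multiples of xy(x - y).
Testing f² against x and y gives f(1,0)²/α² = f(1,1)²/γ² = f(0,1)²/β², so up to scaling f takes the
values ±α, ±β, γ at the three points: four sign choices, four symbols. -/
lemma realizes_threeLines (hp : 2 < p) (α β γ : ℤ) (hα : (α : ZMod p) ≠ 0)
    (hβ : (β : ZMod p) ≠ 0) (hγ : (γ : ZMod p) ≠ 0) :
    Realizes p (threeLineQuintic p α β γ) typeThreeLines
      (-(jacobiSym ((γ - α - β) ^ 2 - 4 * α * β) p + jacobiSym ((γ - α + β) ^ 2 + 4 * α * β) p +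
        jacobiSym ((γ + α - β) ^ 2 + 4 * α * β) p + jacobiSym ((γ + α + β) ^ 2 - 4 * α * β) p)) := by
  have h2 := ne_zero_of_two_lt hp
  have hα' := inv_ne_zero hα
  have hβ' := inv_ne_zero hβ
  have hγ' := inv_ne_zero hγ
  rw [threeLineQuintic_eq]
  refine realizes_of_cubic hp (fun f hf => binForm_eq_zero_of_forall ?_)
    (φ := binForm ![0, 1, -1, 0]) ?_ ?_ ?_ ?_
  · rintro a rfl
    obtain ⟨e0, e1, e2, e3⟩ := (isApolar_quadratic_iff _ _).1 hf
    simp at e0 e1 e2 e3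
    have hs : a 0 + a 1 + a 2 = 0 := by
      apply mul_left_cancel₀ (pow_ne_zero 2 hγ')
      linear_combination -e1
    have h0 : a 0 = 0 := by
      apply mul_left_cancel₀ (pow_ne_zero 2 hα')
      linear_combination e0 + (γ : ZMod p)⁻¹ ^ 2 * hs
    have h2 : a 2 = 0 := by
      apply mul_left_cancel₀ (pow_ne_zero 2 hβ')
      linear_combination e3 + (γ : ZMod p)⁻¹ ^ 2 * hs
    exact ⟨h0, by simpa [h0, h2] using hs, h2⟩
  · rw [isApolar_cubic_iff]
    simp
  · rw [Ne, binForm_eq_zero]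
    intro h
    simpa using congrFun h 1
  · refine hasSplittingType_of_linear ![![1, 0], ![0, 1], ![1, -1]] ![1, 1, 1] ?_ ?_ ?_ ?_
    · intro i
      fin_cases i <;> simp
    · intro i j hij
      fin_cases i <;> fin_cases j <;> simp_all
    · decide
    · simp [coe_linear, coe_cubic, Fin.prod_univ_three]
      ring
  -- The solution normalised by f(1,1) = γ, indexed by the signs of f(1,0) and f(0,1).
  · let v (i : ℤˣ × ℤˣ) : Fin 3 → ZMod p := ![(i.1 : ℤ) * α, γ - (i.1 : ℤ) * α - (i.2 : ℤ) * β,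
      (i.2 : ℤ) * β]
    have hsq (u : ℤˣ) : (((u : ℤ) : ZMod p)) ^ 2 = 1 := by
      rcases Int.units_eq_one_or u with rfl | rfl <;> simp
    have hunit {a b : ZMod p} (h : a ^ 2 = b ^ 2) : ∃ u : ℤˣ, a = (u : ℤ) * b := by
      rcases sq_eq_sq_iff_eq_or_eq_neg.1 h with h | h
      · exact ⟨1, by simpa using h⟩
      · exact ⟨-1, by simpa using h⟩
    have hunit_inj {u u' : ℤˣ} (h : ((u : ℤ) : ZMod p) = (u' : ℤ)) : u = u' := by
      rcases Int.units_eq_one_or u with rfl | rfl <;>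
        rcases Int.units_eq_one_or u' with rfl | rfl
      · rfl
      · push_cast at h
        exact absurd (by linear_combination h) h2
      · push_cast at h
        exact absurd (by linear_combination -h) h2
      · rfl
    rw [quinticC, sum_apolar_squares_eq _ v]
    · have hD (i : ℤˣ × ℤˣ) : v i 1 ^ 2 - 4 * v i 0 * v i 2 =
          (((γ - i.1 * α - i.2 * β) ^ 2 - 4 * (i.1 * α) * (i.2 * β) : ℤ) : ZMod p) := by
        simp [v]
      simp only [hD, quadraticChar_intCast, Fintype.sum_prod_type]
      have hsum (F : ℤˣ → ℤ) : ∑ u, F u = F 1 + F (-1) := by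
        rw [show (Finset.univ : Finset ℤˣ) = {1, -1} from rfl, Finset.sum_pair (by decide)]
      simp only [hsum]
      push_cast
      ring_nf
    · intro i h
      have e0 : ((i.1 : ℤ) : ZMod p) * α = 0 := congrFun h 0
      rcases mul_eq_zero.1 e0 with h | h
      · simpa [h] using hsq i.1
      · exact hα h
    · intro i j c h
      have e0 : ((i.1 : ℤ) : ZMod p) * α = c * ((j.1 : ℤ) * α) := congrFun h 0
      have e1 : γ - ((i.1 : ℤ) : ZMod p) * α - (i.2 : ℤ) * β =
        c * (γ - (j.1 : ℤ) * α - (j.2 : ℤ) * β) := congrFun h 1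
      have e2 : ((i.2 : ℤ) : ZMod p) * β = c * ((j.2 : ℤ) * β) := congrFun h 2
      -- The coordinates of each solution sum to γ ≠ 0, which fixes the scalar.
      have hc : c = 1 := by
        apply mul_right_cancel₀ hγ
        linear_combination -e0 - e1 - e2
      subst hc
      rw [one_mul] at e0 e2
      exact Prod.ext (hunit_inj (mul_right_cancel₀ hα e0)) (hunit_inj (mul_right_cancel₀ hβ e2))
    · intro i
      rw [isApolar_sq_iff]
      have h1 := hsq i.1
      have h2 := hsq i.2
      simp [v]
      constructor
      · field_simp
        linear_combination (γ : ZMod p) ^ 2 * h1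
      · field_simp
        linear_combination (γ : ZMod p) ^ 2 * h2
    · intro f hf
      obtain ⟨e0, e1⟩ := (isApolar_sq_iff _ _).1 hf
      simp at e0 e1
      have s0 : f 0 ^ 2 = (α * ((f 0 + f 1 + f 2) / γ)) ^ 2 := by
        field_simp
        field_simp at e0
        linear_combination e0
      have s2 : f 2 ^ 2 = (β * ((f 0 + f 1 + f 2) / γ)) ^ 2 := by
        field_simp
        field_simp at e1
        linear_combination e1
      obtain ⟨u, hu⟩ := hunit s0
      obtain ⟨u', hu'⟩ := hunit s2
      refine ⟨(u, u'), (f 0 + f 1 + f 2) / γ, ?_⟩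
      ext i
      fin_cases i
      · simp [v]
        linear_combination hu
      · simp [v]
        have : (f 0 + f 1 + f 2) / γ * (γ : ZMod p) = f 0 + f 1 + f 2 := by field_simp
        linear_combination -this - hu - hu'
      · simp [v]
        linear_combination hu'

end Families

/-! ### The examples -/

/-- Integer lifts of the parameters make the hypotheses numerical: divisibilities and Jacobi symbols
of explicit integers. -/
lemma realizes_threeLines_of_jacobiSym {p : ℕ} (hp : p.Prime) (h2 : 2 < p) {α β γ : ZMod p}
    (a b g : ℤ) {c : ℤ} (hα : α = a) (hβ : β = b) (hγ : γ = g) (hα0 : ¬ (p : ℤ) ∣ a)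
    (hβ0 : ¬ (p : ℤ) ∣ b) (hγ0 : ¬ (p : ℤ) ∣ g)
    (hc : -(jacobiSym ((g - a - b) ^ 2 - 4 * a * b) p +
      jacobiSym ((g - a + b) ^ 2 + 4 * a * b) p + jacobiSym ((g + a - b) ^ 2 + 4 * a * b) p +
      jacobiSym ((g + a + b) ^ 2 - 4 * a * b) p) = c) :
    Realizes p (threeLineQuintic p α β γ) typeThreeLines c := by
  have : Fact p.Prime := ⟨hp⟩
  rw [← ZMod.intCast_zmod_eq_zero_iff_dvd] at hα0 hβ0 hγ0
  subst hα hβ hγ hc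
  exact realizes_threeLines h2 a b g hα0 hβ0 hγ0

lemma realizes_squareLine_of_jacobiSym {p : ℕ} (hp : p.Prime) (h2 : 2 < p) {t : ZMod p}
    (a : ℤ) {c : ℤ} (ht : t = a)
    (hc : -(1 + jacobiSym (a ^ 2 - 16) p + jacobiSym (a ^ 2 + 16) p) = c) :
    Realizes p (dualForm ![-1, 0, 0, 0, 1, t]) typeSquareLine c := by
  have : Fact p.Prime := ⟨hp⟩
  subst ht hc
  exact realizes_squareLine h2 a

lemma realizes_cube_of_jacobiSym {p : ℕ} (hp : p.Prime) (h2 : 2 < p) {t : ZMod p}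
    (a : ℤ) {c : ℤ} (ht : t = a) (hc : -jacobiSym (8 * a - 5) p = c) :
    Realizes p (dualForm ![0, 0, 0, 1, 1, t]) typeCube c := by
  have : Fact p.Prime := ⟨hp⟩
  subst ht hc
  exact realizes_cube h2 a

theorem mainTheorem8 :
    -- every listed value is attained, for each of the three Waring types
    (∀ c ∈ ({0, 1, -1} : Set ℤ),
      ∃ (p : ℕ) (w : DualBinForm (ZMod p) 5), Realizes p w typeCube c) ∧
    (∀ c ∈ ({0, 1, -1, -2, -3} : Set ℤ),
      ∃ (p : ℕ) (w : DualBinForm (ZMod p) 5), Realizes p w typeSquareLine c) ∧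
    (∀ c : ℤ, |c| ≤ 4 →
      ∃ (p : ℕ) (w : DualBinForm (ZMod p) 5), Realizes p w typeThreeLines c) ∧
    -- explicit examples of type `⟨1³⟩`
    Realizes 7 (dualForm ![0, 0, 0, 1, 1, -2]) typeCube 0 ∧
    Realizes 7 (dualForm ![0, 0, 0, 1, 1, 0]) typeCube (-1) ∧
    Realizes 7 (dualForm ![0, 0, 0, 1, 1, 1]) typeCube 1 ∧
    -- explicit examples of type `⟨1², 1⟩`
    Realizes 19 (dualForm ![-1, 0, 0, 0, 1, 2]) typeSquareLine (-3) ∧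
    Realizes 7 (dualForm ![-1, 0, 0, 0, 1, 3]) typeSquareLine (-2) ∧
    Realizes 7 (dualForm ![-1, 0, 0, 0, 1, 0]) typeSquareLine (-1) ∧
    Realizes 11 (dualForm ![-1, 0, 0, 0, 1, 4]) typeSquareLine 0 ∧
    Realizes 7 (dualForm ![-1, 0, 0, 0, 1, 1]) typeSquareLine 1 ∧
    -- explicit examples of type `⟨1, 1, 1⟩`
    Realizes 337 (threeLineQuintic 337 1 2 3) typeThreeLines (-4) ∧
    Realizes 13 (threeLineQuintic 13 1 3 4) typeThreeLines (-3) ∧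
    Realizes 47 (threeLineQuintic 47 1 2 3) typeThreeLines (-2) ∧
    Realizes 11 (threeLineQuintic 11 1 1 4) typeThreeLines (-1) ∧
    Realizes 113 (threeLineQuintic 113 1 2 3) typeThreeLines 0 ∧
    Realizes 41 (threeLineQuintic 41 1 2 4) typeThreeLines 1 ∧
    Realizes 17 (threeLineQuintic 17 1 2 3) typeThreeLines 2 ∧
    Realizes 7 (threeLineQuintic 7 1 2 4) typeThreeLines 3 ∧
    Realizes 79 (threeLineQuintic 79 1 2 3) typeThreeLines 4 := by
  have hc0 : Realizes 7 (dualForm ![0, 0, 0, 1, 1, -2]) typeCube 0 :=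
    realizes_cube_of_jacobiSym (by norm_num) (by norm_num) (-2) (by norm_num) (by norm_num)
  have hcm1 : Realizes 7 (dualForm ![0, 0, 0, 1, 1, 0]) typeCube (-1) :=
    realizes_cube_of_jacobiSym (by norm_num) (by norm_num) 0 (by norm_num) (by norm_num)
  have hc1 : Realizes 7 (dualForm ![0, 0, 0, 1, 1, 1]) typeCube 1 :=
    realizes_cube_of_jacobiSym (by norm_num) (by norm_num) 1 (by norm_num) (by norm_num)
  have hsm3 : Realizes 19 (dualForm ![-1, 0, 0, 0, 1, 2]) typeSquareLine (-3) :=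
    realizes_squareLine_of_jacobiSym (by norm_num) (by norm_num) 2 (by norm_num) (by norm_num)
  have hsm2 : Realizes 7 (dualForm ![-1, 0, 0, 0, 1, 3]) typeSquareLine (-2) :=
    realizes_squareLine_of_jacobiSym (by norm_num) (by norm_num) 3 (by norm_num) (by norm_num)
  have hsm1 : Realizes 7 (dualForm ![-1, 0, 0, 0, 1, 0]) typeSquareLine (-1) :=
    realizes_squareLine_of_jacobiSym (by norm_num) (by norm_num) 0 (by norm_num) (by norm_num)
  have hs0 : Realizes 11 (dualForm ![-1, 0, 0, 0, 1, 4]) typeSquareLine 0 :=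
    realizes_squareLine_of_jacobiSym (by norm_num) (by norm_num) 4 (by norm_num) (by norm_num)
  have hs1 : Realizes 7 (dualForm ![-1, 0, 0, 0, 1, 1]) typeSquareLine 1 :=
    realizes_squareLine_of_jacobiSym (by norm_num) (by norm_num) 1 (by norm_num) (by norm_num)
  have htm4 : Realizes 337 (threeLineQuintic 337 1 2 3) typeThreeLines (-4) :=
    realizes_threeLines_of_jacobiSym (by norm_num) (by norm_num) 1 2 3 (by norm_num)
      (by norm_num) (by norm_num) (by norm_num) (by norm_num) (by norm_num) (by norm_num)
  have htm3 : Realizes 13 (threeLineQuintic 13 1 3 4) typeThreeLines (-3) :=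
    realizes_threeLines_of_jacobiSym (by norm_num) (by norm_num) 1 3 4 (by norm_num)
      (by norm_num) (by norm_num) (by norm_num) (by norm_num) (by norm_num) (by norm_num)
  have htm2 : Realizes 47 (threeLineQuintic 47 1 2 3) typeThreeLines (-2) :=
    realizes_threeLines_of_jacobiSym (by norm_num) (by norm_num) 1 2 3 (by norm_num)
      (by norm_num) (by norm_num) (by norm_num) (by norm_num) (by norm_num) (by norm_num)
  have htm1 : Realizes 11 (threeLineQuintic 11 1 1 4) typeThreeLines (-1) :=
    realizes_threeLines_of_jacobiSym (by norm_num) (by norm_num) 1 1 4 (by norm_num)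
      (by norm_num) (by norm_num) (by norm_num) (by norm_num) (by norm_num) (by norm_num)
  have ht0 : Realizes 113 (threeLineQuintic 113 1 2 3) typeThreeLines 0 :=
    realizes_threeLines_of_jacobiSym (by norm_num) (by norm_num) 1 2 3 (by norm_num)
      (by norm_num) (by norm_num) (by norm_num) (by norm_num) (by norm_num) (by norm_num)
  have ht1 : Realizes 41 (threeLineQuintic 41 1 2 4) typeThreeLines 1 :=
    realizes_threeLines_of_jacobiSym (by norm_num) (by norm_num) 1 2 4 (by norm_num)
      (by norm_num) (by norm_num) (by norm_num) (by norm_num) (by norm_num) (by norm_num)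
  have ht2 : Realizes 17 (threeLineQuintic 17 1 2 3) typeThreeLines 2 :=
    realizes_threeLines_of_jacobiSym (by norm_num) (by norm_num) 1 2 3 (by norm_num)
      (by norm_num) (by norm_num) (by norm_num) (by norm_num) (by norm_num) (by norm_num)
  have ht3 : Realizes 7 (threeLineQuintic 7 1 2 4) typeThreeLines 3 :=
    realizes_threeLines_of_jacobiSym (by norm_num) (by norm_num) 1 2 4 (by norm_num)
      (by norm_num) (by norm_num) (by norm_num) (by norm_num) (by norm_num) (by norm_num)
  have ht4 : Realizes 79 (threeLineQuintic 79 1 2 3) typeThreeLines 4 :=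
    realizes_threeLines_of_jacobiSym (by norm_num) (by norm_num) 1 2 3 (by norm_num)
      (by norm_num) (by norm_num) (by norm_num) (by norm_num) (by norm_num) (by norm_num)
  refine ⟨?_, ?_, ?_, hc0, hcm1, hc1, hsm3, hsm2, hsm1, hs0, hs1, htm4, htm3, htm2, htm1, ht0, ht1, ht2, ht3, ht4⟩
  · rintro c (rfl | rfl | rfl)
    · exact ⟨_, _, hc0⟩
    · exact ⟨_, _, hc1⟩
    · exact ⟨_, _, hcm1⟩
  · rintro c (rfl | rfl | rfl | rfl | rfl)
    · exact ⟨_, _, hs0⟩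
    · exact ⟨_, _, hs1⟩
    · exact ⟨_, _, hsm1⟩
    · exact ⟨_, _, hsm2⟩
    · exact ⟨_, _, hsm3⟩
  · intro c hc
    obtain ⟨h1, h2⟩ := abs_le.1 hc
    interval_cases c
    · exact ⟨_, _, htm4⟩
    · exact ⟨_, _, htm3⟩
    · exact ⟨_, _, htm2⟩
    · exact ⟨_, _, htm1⟩
    · exact ⟨_, _, ht0⟩
    · exact ⟨_, _, ht1⟩
    · exact ⟨_, _, ht2⟩
    · exact ⟨_, _, ht3⟩
    · exact ⟨_, _, ht4⟩
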